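/- \textbf{Setting.} Let $x_1,x_2,\dots$ be i.i.d. random variables, uniform on $[0,1]$, and let $n\ge 1$. At time $i\in\{1,\dots,n\}$ the cost $x_i$ is revealed and an integer duration $t_i\ge 0$ is fixed irrevocably; applicant $i$ is then employed in the steps $i,\dots,i+t_i-1$. The durations are \emph{feasible} if every step $1,\dots,n$ is covered, i.e. for each $i\le n$ there is $j\le i$ with $i<j+t_j$. Their cost is $\sum_{i=1}^n t_i x_i$. Let $\mathrm{Opt}_n$ be the infimum of this cost over all feasible durations, chosen with full knowledge of $x_1,\dots,x_n$. \textbf{Algorithm} (with $c=3/4$). Start with $\tau\leftarrow 1$, $t\leftarrow 1$. For $i=1,\dots,n$ do: set $t\leftarrow t-1$. If $x_i\le\tau$: while $x_i\le \tau$ set $\tau\leftarrow\tau/2$; then hire applicant $i$ for $\lceil 2c/\tau\rceil$ steps; if $i+\lceil 2c/\tau\rceil>n$, stop; otherwise set $t\leftarrow\lceil c/\tau\rceil$. If instead $x_i>\tau$ and $t=0$: set $\tau\leftarrow 2\tau$ and then $t\leftarrow\lceil c/\tau\rceil$. Let $\mathrm{Alg}^{\mathrm{full}}_n$ be the cost of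 the algorithm when each hired applicant is paid for the full duration $\lceil 2c/\tau\rceil$, even beyond step $n$, and let $\mathrm{Alg}_n$ be its cost when contracts end with step $n$, i.e. applicant $i$ is hired and paid for $\min(\lceil 2c/\tau\rceil,\,n+1-i)$ steps. \textbf{Theorem.} For $c=3/4$ the algorithm is strictly $2.965$-competitive for the uniform distribution on $[0,1]$. Precisely, for every $n\ge1$: \begin{enumerate} \item both versions are online (the duration $t_i$ depends only on $x_1,\dots,x_i$), and their durations are feasible whenever $x_1,\dots,x_n\in(0,1]$; \item $\mathrm{Opt}_n$, $\mathrm{Alg}_n$ and $\mathrm{Alg}^{\mathrm{full}}_n$ are integrable, and $\mathbf E[\mathrm{Opt}_n]=\mathcal H_{n+1}-1$, where $\mathcal H_m=\sum_{k=1}^m 1/k$; \item $\mathbf E[\mathrm{Alg}_n]\le 2.965\cdot\mathbf E[\mathrm{Opt}_n]$; \item if $n\ge 2$, also $\mathbf E[\mathrm{Alg}^{\mathrm{full}}_n]\le 2.965\cdot\mathbf E[\mathrm{Opt}_n]$. \end{enumerate} -/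

import Mathlib

open MeasureTheory ProbabilityTheory

namespace HiringOverTime

/-- A hiring plan `t` (applicant `i ≥ 1` is employed during the steps `i, …, i + t i - 1`) covers
each of the time steps `1, …, n`. -/
def Covers (n : ℕ) (t : ℕ → ℕ) : Prop :=
  ∀ i ∈ Finset.Icc 1 n, ∃ j ∈ Finset.Icc 1 i, i < j + t j

/-- Total cost of the plan `t` when applicant `i` costs `x i` per time step. -/
noncomputable def planCost (n : ℕ) (t : ℕ → ℕ) (x : ℕ → ℝ) : ℝ :=
  ∑ i ∈ Finset.Icc 1 n, (t i : ℝ) * x i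

/-- Cost of an optimal offline solution (a prophet who knows all of `x` in advance). -/
noncomputable def offlineOpt (n : ℕ) (x : ℕ → ℝ) : ℝ :=
  ⨅ t : {t : ℕ → ℕ // Covers n t}, planCost n t.1 x

/-- A map from cost sequences to hiring plans is online if the duration chosen at time `i` is
determined by the costs revealed up to time `i`. -/
def IsOnline (A : (ℕ → ℝ) → ℕ → ℕ) : Prop :=
  ∀ (x y : ℕ → ℝ) (i : ℕ), (∀ j ∈ Finset.Icc 1 i, x j = y j) → A x i = A y i

/-- Variables of the algorithm: the current threshold cost `τ`, the remaining time `t` with this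
threshold, and whether the algorithm has stopped. -/
structure AlgState where
  threshold : ℝ
  timer : ℕ
  stopped : Bool

/-- The effect on `τ` of the loop `while x ≤ τ do τ ← τ / 2`. The loop terminates for `x > 0`; for
`x ≤ 0 < τ` it does not, and the value here is then `τ`. -/
noncomputable def halveWhile (τ x : ℝ) : ℝ :=
  τ / 2 ^ sInf {k : ℕ | τ / 2 ^ k < x}

open Classical in
/-- Time step `i` of the algorithm with parameter `c` and horizon `n`, on seeing the cost `x`:
the duration for which applicant `i` is hired (`0` if not hired), and the new state. -/
noncomputable def step (c : ℝ) (n i : ℕ) (s : AlgState) (x : ℝ) : ℕ × AlgState :=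
  if s.stopped then (0, s)
  else if x ≤ s.threshold then
    let τ := halveWhile s.threshold x
    let d := ⌈2 * c / τ⌉₊
    if n < i + d then (d, ⟨τ, s.timer - 1, true⟩) else (d, ⟨τ, ⌈c / τ⌉₊, false⟩)
  else if s.timer - 1 = 0 then
    let τ := 2 * s.threshold
    (0, ⟨τ, ⌈c / τ⌉₊, false⟩)
  else (0, ⟨s.threshold, s.timer - 1, false⟩)

/-- State of the algorithm after time step `i`. -/
noncomputable def stateAfter (c : ℝ) (n : ℕ) (x : ℕ → ℝ) : ℕ → AlgState
  | 0 => ⟨1, 1, false⟩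
  | i + 1 => (step c n (i + 1) (stateAfter c n x i) (x (i + 1))).2

/-- The hiring durations chosen by the algorithm. -/
noncomputable def algorithm (c : ℝ) (n : ℕ) (x : ℕ → ℝ) : ℕ → ℕ
  | 0 => 0
  | i + 1 => (step c n (i + 1) (stateAfter c n x i) (x (i + 1))).1

/-- The same decisions, where contracts end with the last time step `n`: applicant `i` is
employed (and paid) for at most the `n + 1 - i` time steps `i, …, n`. -/
noncomputable def truncatedAlgorithm (c : ℝ) (n : ℕ) (x : ℕ → ℝ) (i : ℕ) : ℕ :=
  min (algorithm c n x i) (n + 1 - i)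

end HiringOverTime

/-! The offline optimum pays in every step the smallest cost seen so far (`offlineOpt_eq`), and the
minimum of i uniform costs has mean 1/(i+1) (`integral_argminUpTo`). This yields the harmonic
number.

All thresholds are powers 2⁻ᵏ. A hire that lowers the threshold to 2⁻ʲ has cost uniform on (2⁻ʲ,
2¹⁻ʲ], with mean (3/2)·2⁻ʲ, and a contract of (3/2)·2ʲ steps. So every hire costs 9/4 in
expectation, and it remains to count hires.

Let e_k be the expected number of hires from the start of a phase with threshold 2⁻ᵏ until the
threshold is below 2⁻ᵏ, and q_k the probability that the phase passes without a hire. After such a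
phase, the hire that brings the threshold below 2¹⁻ᵏ leaves it exactly at 2⁻ᵏ with probability 1/2.
Hence e_k = 1 - q_k + q_k (e_{k-1} + e_k/2), which is solved for e_k in `expectedHires`. If a hire
of level K outlasts the horizon, at most 1 + (1/2) ∑_{1≤j<K} e_j hires are expected. Since e_k ≤
1.82, doubling n adds at most (9/4)·0.91 = 2.0475 to the cost bound, while 2.965·log 2 > 2.055 is
gained on the other side; small n are checked numerically (`exists_totalHires_le`).

The count is made rigorous by the potential `costBound`, which depends on the state but not on the
time: the mean cost of a step plus the mean potential after it is at most the potential before it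
(`integral_stepCost_le`). Independence of the state and the next cost lets these inequalities
telescope. -/

namespace HiringOverTime

/-! ### Finitary description of the algorithm -/

/-- Number of steps that the algorithm with `c = 3 / 4` spends with the threshold `2⁻ᵏ`. -/
def phaseLength : ℕ → ℕ
  | 0 => 1
  | 1 => 2
  | k + 2 => 3 * 2 ^ k

/-- Duration of a contract concluded by lowering the threshold to `2⁻ᵏ`, for `c = 3 / 4`. -/
def contractLength (k : ℕ) : ℕ := 3 * 2 ^ (k - 1)

/-- The `j` with `2⁻ʲ < x ≤ 2⁻⁽ʲ⁻¹⁾`, for `x ∈ (0, 1]`. -/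
noncomputable def level (x : ℝ) : ℕ := sInf {j : ℕ | (1 / 2 : ℝ) ^ j < x}

theorem phaseLength_pos (k : ℕ) : 1 ≤ phaseLength k := by
  rcases k with _ | _ | k
  · simp [phaseLength]
  · simp [phaseLength]
  · have := Nat.one_le_two_pow (n := k)
    simp only [phaseLength]; omega

theorem contractLength_succ (k : ℕ) : contractLength (k + 1) = 3 * 2 ^ k := by
  simp [contractLength]

theorem ceil_phaseLength (k : ℕ) : ⌈(3 / 4 : ℝ) / (1 / 2) ^ k⌉₊ = phaseLength k := by
  rcases k with _ | _ | k
  · rw [Nat.ceil_eq_iff (by simp [phaseLength])]; norm_num [phaseLength]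
  · rw [Nat.ceil_eq_iff (by simp [phaseLength])]; norm_num [phaseLength]
  · have : (3 / 4 : ℝ) / (1 / 2) ^ (k + 2) = ((3 * 2 ^ k : ℕ) : ℝ) := by
      push_cast
      rw [one_div, inv_pow, div_inv_eq_mul, pow_add]
      ring
    rw [this, Nat.ceil_natCast, phaseLength]

theorem ceil_contractLength (k : ℕ) :
    ⌈2 * (3 / 4 : ℝ) / (1 / 2) ^ (k + 1)⌉₊ = contractLength (k + 1) := by
  have : 2 * (3 / 4 : ℝ) / (1 / 2) ^ (k + 1) = ((3 * 2 ^ k : ℕ) : ℝ) := by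
    push_cast
    rw [one_div, inv_pow, div_inv_eq_mul, pow_add]
    ring
  rw [this, Nat.ceil_natCast, contractLength_succ]

/-- This is why the plans are feasible: a contract lasts exactly as long as it takes the threshold,
if nobody else is hired, to climb back through all phases to 1, including the single step at
threshold 1. -/
theorem sum_phaseLength (k : ℕ) :
    ∑ m ∈ Finset.range (k + 2), phaseLength m = contractLength (k + 1) := by
  induction k with
  | zero => simp [Finset.sum_range_succ, phaseLength, contractLength]
  | succ k ih =>
    rw [Finset.sum_range_succ, ih, contractLength_succ, contractLength_succ, phaseLength]
    ring

theorem level_le_iff {x : ℝ} (hx : 0 < x) (j : ℕ) : level x ≤ j ↔ (1 / 2 : ℝ) ^ j < x := by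
  have hne : {j : ℕ | (1 / 2 : ℝ) ^ j < x}.Nonempty :=
    exists_pow_lt_of_lt_one hx (by norm_num)
  refine ⟨fun h => ?_, fun h => Nat.sInf_le h⟩
  have h1 : (1 / 2 : ℝ) ^ level x < x := Nat.sInf_mem hne
  exact (pow_le_pow_of_le_one (by norm_num) (by norm_num) h).trans_lt h1

theorem lt_level_iff {x : ℝ} (hx : 0 < x) (j : ℕ) : j < level x ↔ x ≤ (1 / 2 : ℝ) ^ j := by
  rw [← not_le, level_le_iff hx, not_lt]

theorem level_eq {x : ℝ} {j : ℕ} (h : x ∈ Set.Ioc ((1 / 2 : ℝ) ^ (j + 1)) ((1 / 2) ^ j)) :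
    level x = j + 1 := by
  have hx : 0 < x := lt_trans (by positivity) h.1
  exact le_antisymm ((level_le_iff hx _).2 h.1) ((lt_level_iff hx _).2 h.2)

theorem halveWhile_eq {x : ℝ} (hx : 0 < x) {k : ℕ} (h : x ≤ (1 / 2 : ℝ) ^ k) :
    halveWhile ((1 / 2) ^ k) x = (1 / 2) ^ level x := by
  have hk := (lt_level_iff hx k).2 h
  have e : ∀ m : ℕ, (1 / 2 : ℝ) ^ k / 2 ^ m = (1 / 2) ^ (k + m) := fun m => by
    rw [pow_add, div_eq_mul_inv, one_div (2 : ℝ), inv_pow 2 m]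
  have hs : {m : ℕ | (1 / 2 : ℝ) ^ k / 2 ^ m < x} = Set.Ici (level x - k) := by
    ext m
    rw [Set.mem_ofPred_eq, e, ← level_le_iff hx, Set.mem_Ici]
    omega
  rw [halveWhile, hs, csInf_Ici, e]
  congr 1
  omega

/-- Finitary form of `step` for `c = 3 / 4`: `none` means stopped, `some (k, t)` means threshold
`2⁻ᵏ` and timer `t + 1`. -/
noncomputable def nextPhase (n i : ℕ) : Option (ℕ × ℕ) → ℝ → Option (ℕ × ℕ)
  | none, _ => none
  | some (k, t), x =>
    if x ≤ (1 / 2 : ℝ) ^ k then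
      if n < i + contractLength (level x) then none
      else some (level x, phaseLength (level x) - 1)
    else if t = 0 then some (k - 1, phaseLength (k - 1) - 1) else some (k, t - 1)

/-- Duration for which an applicant of cost `x` is hired. -/
noncomputable def duration : Option (ℕ × ℕ) → ℝ → ℕ
  | none, _ => 0
  | some (k, _), x => if x ≤ (1 / 2 : ℝ) ^ k then contractLength (level x) else 0

/-- The sequence of states of the algorithm in the form used by `nextPhase`. -/
noncomputable def phaseAfter (n : ℕ) (x : ℕ → ℝ) : ℕ → Option (ℕ × ℕ)
  | 0 => some (0, 0)
  | i + 1 => nextPhase n (i + 1) (phaseAfter n x i) (x (i + 1))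

/-- A state of the algorithm is described by its finitary form. -/
def Describes (s : AlgState) : Option (ℕ × ℕ) → Prop
  | none => s.stopped = true
  | some (k, t) => s = ⟨(1 / 2) ^ k, t + 1, false⟩

/-- Thresholds stay powers of 1/2 because halving and doubling preserve them. The timer is stored
reduced by one, so that the test "timer is 0 after the decrement" becomes `t = 0`. -/
theorem step_describes (n i : ℕ) {s : AlgState} {d : Option (ℕ × ℕ)} (h : Describes s d) {x : ℝ}
    (hx : 0 < x) (hx1 : x ≤ 1) :
    (step (3 / 4) n i s x).1 = duration d x ∧
      Describes (step (3 / 4) n i s x).2 (nextPhase n i d x) := by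
  rcases d with _ | ⟨k, t⟩
  · have hs : s.stopped = true := h
    simp [step, hs, duration, nextPhase, Describes]
  · obtain rfl : s = ⟨(1 / 2) ^ k, t + 1, false⟩ := h
    by_cases hxk : x ≤ (1 / 2 : ℝ) ^ k
    · obtain ⟨j, hj⟩ : ∃ j, level x = j + 1 :=
        ⟨level x - 1, by have := (lt_level_iff hx k).2 hxk; omega⟩
      have hp : phaseLength (j + 1) - 1 + 1 = phaseLength (j + 1) := by
        have := phaseLength_pos (j + 1); omega
      simp only [step, nextPhase, duration, hxk, if_true, halveWhile_eq hx hxk, hj,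
        ceil_contractLength, ceil_phaseLength, Bool.false_eq_true, if_false]
      split_ifs with hn
      · exact ⟨rfl, rfl⟩
      · exact ⟨rfl, by simp only [Describes, hp]⟩
    -- At threshold 1 every cost is accepted, so the truncated subtraction in `k - 1` never meets `k
    -- = 0`.
    · have hk : k ≠ 0 := by rintro rfl; exact hxk (by simpa using hx1)
      obtain ⟨m, rfl⟩ := Nat.exists_eq_succ_of_ne_zero hk
      have hp : phaseLength m - 1 + 1 = phaseLength m := by
        have := phaseLength_pos m; omega
      have h2 : 2 * (1 / 2 : ℝ) ^ (m + 1) = (1 / 2) ^ m := by rw [pow_succ]; ring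
      simp only [Nat.succ_eq_add_one] at hxk
      simp only [step, nextPhase, duration, hxk, if_false, Bool.false_eq_true,
        Nat.add_sub_cancel, Nat.succ_eq_add_one, h2, ceil_phaseLength]
      split_ifs with ht
      · exact ⟨rfl, by simp only [Describes, hp]⟩
      · exact ⟨rfl, by
          have : t - 1 + 1 = t := by omega
          simp only [Describes, this]⟩

theorem stateAfter_describes {n : ℕ} {x : ℕ → ℝ} (hx : ∀ i ∈ Finset.Icc 1 n, 0 < x i ∧ x i ≤ 1)
    {i : ℕ} (hi : i ≤ n) : Describes (stateAfter (3 / 4) n x i) (phaseAfter n x i) := by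
  induction i with
  | zero => simp [stateAfter, phaseAfter, Describes]
  | succ i ih =>
    have := hx (i + 1) (Finset.mem_Icc.2 ⟨by omega, hi⟩)
    exact (step_describes n (i + 1) (ih (by omega)) this.1 this.2).2

theorem algorithm_eq_duration {n : ℕ} {x : ℕ → ℝ}
    (hx : ∀ i ∈ Finset.Icc 1 n, 0 < x i ∧ x i ≤ 1) {i : ℕ} (hi : i < n) :
    algorithm (3 / 4) n x (i + 1) = duration (phaseAfter n x i) (x (i + 1)) := by
  have := hx (i + 1) (Finset.mem_Icc.2 ⟨by omega, hi⟩)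
  exact (step_describes n (i + 1) (stateAfter_describes hx hi.le) this.1 this.2).1

/-! ### Feasibility -/

/-- The coverage guarantee carried by a state: all steps up to the time at which the threshold
would again reach `1` are covered. -/
def CoverageInvariant (n i : ℕ) (t : ℕ → ℕ) : Option (ℕ × ℕ) → Prop
  | none => Covers n t
  | some (k, m) => ∀ s, 1 ≤ s → s < i + m + 1 + ∑ l ∈ Finset.range k, phaseLength l →
      ∃ j ∈ Finset.Icc 1 s, s < j + t j

theorem coverageInvariant_phaseAfter {n : ℕ} {x : ℕ → ℝ}
    (hx : ∀ i ∈ Finset.Icc 1 n, 0 < x i ∧ x i ≤ 1) {i : ℕ} (hi : i ≤ n) :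
    CoverageInvariant n i (algorithm (3 / 4) n x) (phaseAfter n x i) := by
  induction i with
  | zero => intro s h1 h2; simp at h2; omega
  | succ i ih =>
    have ih := ih (by omega)
    have hd := algorithm_eq_duration hx (i := i) (by omega)
    obtain ⟨hx0, hx1⟩ := hx (i + 1) (Finset.mem_Icc.2 ⟨by omega, hi⟩)
    rw [phaseAfter]
    rcases hp : phaseAfter n x i with _ | ⟨k, m⟩
    · rw [hp] at ih
      simpa [nextPhase, CoverageInvariant] using ih
    · rw [hp] at ih hd
      have ih : ∀ s, 1 ≤ s → s < i + m + 1 + ∑ l ∈ Finset.range k, phaseLength l →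
        ∃ j ∈ Finset.Icc 1 s, s < j + algorithm (3 / 4) n x j := ih
      simp only [nextPhase]
      by_cases hxk : x (i + 1) ≤ (1 / 2 : ℝ) ^ k
      · obtain ⟨j, hj⟩ : ∃ j, level (x (i + 1)) = j + 1 :=
          ⟨level (x (i + 1)) - 1, by have := (lt_level_iff hx0 k).2 hxk; omega⟩
        simp only [duration, hxk, if_true, hj] at hd
        have key : ∀ s, 1 ≤ s → s < i + 1 + contractLength (j + 1) →
            ∃ j ∈ Finset.Icc 1 s, s < j + algorithm (3 / 4) n x j := by
          intro s h1 h2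
          by_cases hs : s ≤ i
          · exact ih s h1 (by omega)
          · exact ⟨i + 1, Finset.mem_Icc.2 ⟨by omega, by omega⟩, by rw [hd]; exact h2⟩
        simp only [hxk, if_true, hj]
        split_ifs with hn
        · intro s hs
          rw [Finset.mem_Icc] at hs
          exact key s hs.1 (by omega)
        · intro s h1 h2
          refine key s h1 ?_
          -- The new guarantee ends exactly where the contract does.
          have h3 := sum_phaseLength j
          rw [Finset.sum_range_succ] at h3
          have := phaseLength_pos (j + 1)
          omega
      · have hk : k ≠ 0 := by rintro rfl; exact hxk (by simpa using hx1)
        obtain ⟨l, rfl⟩ := Nat.exists_eq_succ_of_ne_zero hk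
        rw [if_neg hxk]
        split_ifs with hm
        · intro s h1 h2
          refine ih s h1 ?_
          rw [Nat.succ_eq_add_one, Finset.sum_range_succ]
          have := phaseLength_pos l
          simp only [Nat.succ_eq_add_one, Nat.add_sub_cancel] at h2
          omega
        · intro s h1 h2
          exact ih s h1 (by omega)

theorem covers_algorithm {n : ℕ} {x : ℕ → ℝ} (hx : ∀ i ∈ Finset.Icc 1 n, 0 < x i ∧ x i ≤ 1) :
    Covers n (algorithm (3 / 4) n x) := by
  have h := coverageInvariant_phaseAfter hx le_rfl
  rcases hp : phaseAfter n x n with _ | ⟨k, m⟩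
  · rw [hp] at h; exact h
  · rw [hp] at h
    intro s hs
    rw [Finset.mem_Icc] at hs
    exact h s hs.1 (by omega)

theorem Covers.min_remaining {n : ℕ} {t : ℕ → ℕ} (h : Covers n t) :
    Covers n (fun i => min (t i) (n + 1 - i)) := by
  intro s hs
  obtain ⟨j, hj, hlt⟩ := h s hs
  refine ⟨j, hj, ?_⟩
  rw [Finset.mem_Icc] at hs hj
  simp only
  omega

/-! ### Online property -/

theorem stateAfter_congr (c : ℝ) (n : ℕ) {x y : ℕ → ℝ} {i : ℕ}
    (h : ∀ j ∈ Finset.Icc 1 i, x j = y j) : stateAfter c n x i = stateAfter c n y i := by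
  induction i with
  | zero => rfl
  | succ i ih =>
    rw [stateAfter, stateAfter, h (i + 1) (by simp),
      ih fun j hj => h j (Finset.Icc_subset_Icc_right (Nat.le_succ i) hj)]

theorem isOnline_algorithm (c : ℝ) (n : ℕ) : IsOnline (algorithm c n) := by
  rintro x y (_ | i) h
  · rfl
  · rw [algorithm, algorithm, h (i + 1) (by simp),
      stateAfter_congr c n fun j hj => h j (Finset.Icc_subset_Icc_right (Nat.le_succ i) hj)]

theorem isOnline_truncatedAlgorithm (c : ℝ) (n : ℕ) : IsOnline (truncatedAlgorithm c n) :=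
  fun x y i h => by
    rw [truncatedAlgorithm, truncatedAlgorithm, isOnline_algorithm c n x y i h]

/-! ### The offline optimum as a sum of prefix minima -/

/-- Index of the first minimum among `x 1, …, x i`. -/
noncomputable def argminUpTo (x : ℕ → ℝ) : ℕ → ℕ
  | 0 => 1
  | i + 1 => if x (i + 1) < x (argminUpTo x i) then i + 1 else argminUpTo x i

theorem apply_argminUpTo_succ (x : ℕ → ℝ) (i : ℕ) :
    x (argminUpTo x (i + 1)) = min (x (argminUpTo x i)) (x (i + 1)) := by
  rw [argminUpTo]
  split_ifs with h
  · rw [min_eq_right h.le]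
  · rw [min_eq_left (not_lt.1 h)]

theorem lt_apply_argminUpTo_iff (x : ℕ → ℝ) {i : ℕ} (hi : 1 ≤ i) (t : ℝ) :
    t < x (argminUpTo x i) ↔ ∀ j ∈ Finset.Icc 1 i, t < x j := by
  induction i, hi using Nat.le_induction with
  | base => simp [argminUpTo]
  | succ i hi ih =>
    rw [apply_argminUpTo_succ x i, lt_min_iff, ih,
      ← Finset.insert_Icc_right_eq_Icc_add_one (by omega : 1 ≤ i + 1), Finset.forall_mem_insert,
      and_comm]

theorem apply_argminUpTo_le (x : ℕ → ℝ) {i j : ℕ} (hj : j ∈ Finset.Icc 1 i) :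
    x (argminUpTo x i) ≤ x j := by
  have hi : 1 ≤ i := (Finset.mem_Icc.1 hj).1.trans (Finset.mem_Icc.1 hj).2
  by_contra! h
  exact lt_irrefl _ ((lt_apply_argminUpTo_iff x hi _).1 h j hj)

theorem argminUpTo_mem_Icc (x : ℕ → ℝ) {i : ℕ} (hi : 1 ≤ i) :
    argminUpTo x i ∈ Finset.Icc 1 i := by
  induction i, hi using Nat.le_induction with
  | base => simp [argminUpTo]
  | succ i hi ih =>
    rw [argminUpTo]
    rw [Finset.mem_Icc] at ih
    split_ifs
    · simp
    · exact Finset.mem_Icc.2 ⟨ih.1, by omega⟩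

theorem argminUpTo_eq_of_le (x : ℕ → ℝ) {i m : ℕ} (h1 : argminUpTo x i ≤ m) (h2 : m ≤ i) :
    argminUpTo x m = argminUpTo x i := by
  induction i with
  | zero =>
    obtain rfl : m = 0 := by omega
    rfl
  | succ i ih =>
    rcases Nat.lt_or_ge m (i + 1) with h | h
    · have e : argminUpTo x (i + 1) = argminUpTo x i := by
        have : argminUpTo x (i + 1) =
          if x (i + 1) < x (argminUpTo x i) then i + 1 else argminUpTo x i := rfl
        split_ifs at this with hlt
        · omega
        · exact this
      rw [e] at h1 ⊢
      exact ih h1 (by omega)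
    · rw [le_antisymm h2 h]

/-- A plan that always employs the first cheapest applicant seen so far. -/
noncomputable def prefixMinPlan (n : ℕ) (x : ℕ → ℝ) (j : ℕ) : ℕ :=
  ((Finset.Icc 1 n).filter fun s => argminUpTo x s = j).card

/-- The steps whose prefix minimum sits at `j` form an interval starting at `j`, so their number is
a valid duration. -/
theorem covers_prefixMinPlan (n : ℕ) (x : ℕ → ℝ) : Covers n (prefixMinPlan n x) := by
  intro s hs
  have hs := Finset.mem_Icc.1 hs
  have hmem := argminUpTo_mem_Icc x hs.1
  refine ⟨argminUpTo x s, hmem, ?_⟩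
  rw [Finset.mem_Icc] at hmem
  have hsub : Finset.Icc (argminUpTo x s) s ⊆
      (Finset.Icc 1 n).filter fun m => argminUpTo x m = argminUpTo x s := by
    intro m hm
    rw [Finset.mem_Icc] at hm
    exact Finset.mem_filter.2 ⟨Finset.mem_Icc.2 ⟨by omega, by omega⟩,
      argminUpTo_eq_of_le x hm.1 hm.2⟩
  have := Finset.card_le_card hsub
  rw [Nat.card_Icc] at this
  rw [prefixMinPlan]
  omega

theorem planCost_prefixMinPlan (n : ℕ) (x : ℕ → ℝ) :
    planCost n (prefixMinPlan n x) x = ∑ s ∈ Finset.Icc 1 n, x (argminUpTo x s) := by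
  have hmaps : ∀ s ∈ Finset.Icc 1 n, argminUpTo x s ∈ Finset.Icc 1 n := fun s hs => by
    have hs := Finset.mem_Icc.1 hs
    have := Finset.mem_Icc.1 (argminUpTo_mem_Icc x hs.1)
    exact Finset.mem_Icc.2 ⟨this.1, by omega⟩
  refine Eq.trans ?_ (Finset.sum_fiberwise_of_maps_to hmaps fun s => x (argminUpTo x s))
  refine Finset.sum_congr rfl fun j _ => ?_
  rw [prefixMinPlan, ← nsmul_eq_mul, ← Finset.sum_const]
  exact Finset.sum_congr rfl fun s hs => by rw [(Finset.mem_filter.1 hs).2]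

/-- Charge each step to some applicant employed in it, who costs at least the prefix minimum, and
exchange the sums. -/
theorem sum_argminUpTo_le_planCost {n : ℕ} {x : ℕ → ℝ} (hx : ∀ i ∈ Finset.Icc 1 n, 0 ≤ x i)
    {t : ℕ → ℕ} (ht : Covers n t) :
    ∑ s ∈ Finset.Icc 1 n, x (argminUpTo x s) ≤ planCost n t x := by
  calc ∑ s ∈ Finset.Icc 1 n, x (argminUpTo x s)
      ≤ ∑ s ∈ Finset.Icc 1 n, ∑ j ∈ Finset.Icc 1 n, if j ≤ s ∧ s < j + t j then x j else 0 := by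
        refine Finset.sum_le_sum fun s hs => ?_
        obtain ⟨j, hj, hlt⟩ := ht s hs
        have hs' := Finset.mem_Icc.1 hs
        have hj' := Finset.mem_Icc.1 hj
        refine (apply_argminUpTo_le x hj).trans ?_
        have := Finset.single_le_sum (s := Finset.Icc 1 n)
          (f := fun j => if j ≤ s ∧ s < j + t j then x j else 0)
          (fun j hj => by
            split_ifs
            · exact hx j hj
            · exact le_rfl) (Finset.mem_Icc.2 ⟨hj'.1, hj'.2.trans hs'.2⟩)
        rwa [if_pos ⟨hj'.2, hlt⟩] at this
    _ = ∑ j ∈ Finset.Icc 1 n, ∑ s ∈ Finset.Icc 1 n, if j ≤ s ∧ s < j + t j then x j else 0 :=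
        Finset.sum_comm
    _ ≤ planCost n t x := by
        refine Finset.sum_le_sum fun j hj => ?_
        rw [← Finset.sum_filter, Finset.sum_const, nsmul_eq_mul]
        refine mul_le_mul_of_nonneg_right ?_ (hx j hj)
        have hsub : (Finset.Icc 1 n).filter (fun s => j ≤ s ∧ s < j + t j) ⊆
            Finset.Ico j (j + t j) := fun s hs =>
          Finset.mem_Ico.2 (Finset.mem_filter.1 hs).2
        have := Finset.card_le_card hsub
        rw [Nat.card_Ico] at this
        exact_mod_cast (by omega)

theorem offlineOpt_eq {n : ℕ} {x : ℕ → ℝ} (hx : ∀ i ∈ Finset.Icc 1 n, 0 ≤ x i) :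
    offlineOpt n x = ∑ s ∈ Finset.Icc 1 n, x (argminUpTo x s) := by
  refine IsLeast.csInf_eq ⟨⟨⟨prefixMinPlan n x, covers_prefixMinPlan n x⟩,
    planCost_prefixMinPlan n x⟩, ?_⟩
  rintro _ ⟨t, rfl⟩
  exact sum_argminUpTo_le_planCost hx t.2

/-! ### Expectation of the optimum for uniform costs -/

section Uniform

variable {Ω : Type*} [MeasurableSpace Ω] {P : Measure Ω}

theorem map_eq_of_isUniform {X : Ω → ℝ} (h : pdf.IsUniform X (Set.Icc (0 : ℝ) 1) P volume) :
    P.map X = volume.restrict (Set.Ioc (0 : ℝ) 1) := by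
  rw [show P.map X = ProbabilityTheory.cond volume (Set.Icc (0 : ℝ) 1) from h,
    ProbabilityTheory.cond, Real.volume_Icc, restrict_Ioc_eq_restrict_Icc]
  simp

theorem ae_mem_Ioc_of_isUniform {X : Ω → ℝ} (hX : Measurable X)
    (h : pdf.IsUniform X (Set.Icc (0 : ℝ) 1) P volume) : ∀ᵐ ω ∂P, 0 < X ω ∧ X ω ≤ 1 := by
  have : ∀ᵐ y ∂(P.map X), y ∈ Set.Ioc (0 : ℝ) 1 := by
    rw [map_eq_of_isUniform h]
    exact ae_restrict_mem measurableSet_Ioc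
  exact ae_of_ae_map hX.aemeasurable this

theorem measure_lt_of_isUniform {X : Ω → ℝ} (hX : Measurable X)
    (h : pdf.IsUniform X (Set.Icc (0 : ℝ) 1) P volume) {t : ℝ} (ht : 0 ≤ t) :
    P (X ⁻¹' Set.Ioi t) = ENNReal.ofReal (1 - t) := by
  rw [← Measure.map_apply hX measurableSet_Ioi, map_eq_of_isUniform h,
    Measure.restrict_apply measurableSet_Ioi, Set.inter_comm, Set.Ioc_inter_Ioi, sup_eq_right.2 ht,
    Real.volume_Ioc]

theorem integrable_of_ae_le [IsFiniteMeasure P] {f : Ω → ℝ} (hf : AEStronglyMeasurable f P)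
    (C : ℝ) (h : ∀ᵐ ω ∂P, 0 ≤ f ω ∧ f ω ≤ C) : Integrable f P :=
  Integrable.of_bound hf C (h.mono fun ω hω => by
    rw [Real.norm_eq_abs, abs_of_nonneg hω.1]; exact hω.2)

theorem measurable_argminUpTo {X : ℕ → Ω → ℝ} (hX : ∀ i, Measurable (X i)) (i : ℕ) :
    Measurable fun ω => X (argminUpTo (fun j => X j ω) i) ω := by
  induction i with
  | zero => exact hX 1
  | succ i ih =>
    have e : (fun ω => X (argminUpTo (fun j => X j ω) (i + 1)) ω) =
        fun ω => min (X (argminUpTo (fun j => X j ω) i) ω) (X (i + 1) ω) :=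
      funext fun ω => apply_argminUpTo_succ (fun j => X j ω) i
    rw [e]
    exact ih.min (hX (i + 1))

theorem integral_one_sub_pow (i : ℕ) : ∫ t in (0 : ℝ)..1, (1 - t) ^ i = 1 / ((i : ℝ) + 1) := by
  rw [intervalIntegral.integral_comp_sub_left (fun t => t ^ i) 1, integral_pow]
  simp

theorem integrable_argminUpTo [IsProbabilityMeasure P] {X : ℕ → Ω → ℝ}
    (hX : ∀ i, Measurable (X i))
    (hU : ∀ i, pdf.IsUniform (X i) (Set.Icc (0 : ℝ) 1) P volume) (i : ℕ) :
    Integrable (fun ω => X (argminUpTo (fun j => X j ω) i) ω) P := by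
  refine integrable_of_ae_le (measurable_argminUpTo hX i).aestronglyMeasurable 1 ?_
  filter_upwards [ae_all_iff.2 fun i => ae_mem_Ioc_of_isUniform (hX i) (hU i)] with ω hω
  exact ⟨(hω _).1.le, (hω _).2⟩

/-- Layer-cake formula: by independence the minimum exceeds t ∈ (0, 1] with probability (1 - t)ⁱ. -/
theorem integral_argminUpTo [IsProbabilityMeasure P] {X : ℕ → Ω → ℝ}
    (hX : ∀ i, Measurable (X i)) (hindep : iIndepFun X P)
    (hU : ∀ i, pdf.IsUniform (X i) (Set.Icc (0 : ℝ) 1) P volume) {i : ℕ} (hi : 1 ≤ i) :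
    ∫ ω, X (argminUpTo (fun j => X j ω) i) ω ∂P = 1 / ((i : ℝ) + 1) := by
  have h0 : ∀ᵐ ω ∂P, 0 ≤ X (argminUpTo (fun j => X j ω) i) ω := by
    filter_upwards [ae_all_iff.2 fun i => ae_mem_Ioc_of_isUniform (hX i) (hU i)] with ω hω
    exact (hω _).1.le
  have hm : ∀ t ∈ Set.Ioi (0 : ℝ), P.real {ω | t < X (argminUpTo (fun j => X j ω) i) ω} =
      (Set.Ioc (0 : ℝ) 1).indicator (fun t => (1 - t) ^ i) t := by
    intro t ht
    have e : {ω | t < X (argminUpTo (fun j => X j ω) i) ω} =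
        ⋂ j ∈ Finset.Icc 1 i, X j ⁻¹' Set.Ioi t := by
      ext ω
      simp only [Set.mem_ofPred_eq, lt_apply_argminUpTo_iff (fun j => X j ω) hi, Set.mem_iInter,
        Set.mem_preimage, Set.mem_Ioi]
    rw [e, measureReal_def, hindep.measure_inter_preimage_eq_mul _ fun _ _ => measurableSet_Ioi,
      Finset.prod_congr rfl fun j _ => measure_lt_of_isUniform (hX j) (hU j) (le_of_lt ht),
      Finset.prod_const, Nat.card_Icc, Nat.add_sub_cancel, ENNReal.toReal_pow]
    by_cases h1 : t ≤ 1
    · rw [Set.indicator_of_mem (Set.mem_Ioc.2 ⟨ht, h1⟩),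
        ENNReal.toReal_ofReal (sub_nonneg.2 h1)]
    · rw [Set.indicator_of_notMem (fun h => h1 h.2), ENNReal.ofReal_of_nonpos (by linarith)]
      -- For t > 1 the product of the zero tails is 0ⁱ, which vanishes only because i ≥ 1.
      simp [show i ≠ 0 by omega]
  rw [(integrable_argminUpTo hX hU i).integral_eq_integral_meas_lt h0,
    setIntegral_congr_fun measurableSet_Ioi hm, setIntegral_indicator measurableSet_Ioc,
    Set.inter_eq_self_of_subset_right Set.Ioc_subset_Ioi_self,
    ← intervalIntegral.integral_of_le zero_le_one, integral_one_sub_pow]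

theorem ae_offlineOpt_eq {X : ℕ → Ω → ℝ} (hX : ∀ i, Measurable (X i))
    (hU : ∀ i, pdf.IsUniform (X i) (Set.Icc (0 : ℝ) 1) P volume) (n : ℕ) :
    (fun ω => offlineOpt n fun i => X i ω) =ᵐ[P]
      fun ω => ∑ s ∈ Finset.Icc 1 n, X (argminUpTo (fun j => X j ω) s) ω := by
  filter_upwards [ae_all_iff.2 fun i => ae_mem_Ioc_of_isUniform (hX i) (hU i)] with ω hω
  exact offlineOpt_eq fun i _ => (hω i).1.le

theorem integrable_offlineOpt [IsProbabilityMeasure P] {X : ℕ → Ω → ℝ}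
    (hX : ∀ i, Measurable (X i))
    (hU : ∀ i, pdf.IsUniform (X i) (Set.Icc (0 : ℝ) 1) P volume) (n : ℕ) :
    Integrable (fun ω => offlineOpt n fun i => X i ω) P := by
  rw [integrable_congr (ae_offlineOpt_eq hX hU n)]
  exact integrable_finsetSum _ fun i _ => integrable_argminUpTo hX hU i

theorem integral_offlineOpt [IsProbabilityMeasure P] {X : ℕ → Ω → ℝ}
    (hX : ∀ i, Measurable (X i)) (hindep : iIndepFun X P)
    (hU : ∀ i, pdf.IsUniform (X i) (Set.Icc (0 : ℝ) 1) P volume) (n : ℕ) :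
    ∫ ω, offlineOpt n (fun i => X i ω) ∂P = ((harmonic (n + 1) : ℚ) : ℝ) - 1 := by
  rw [integral_congr_ae (ae_offlineOpt_eq hX hU n), integral_finsetSum _ fun i _ =>
      integrable_argminUpTo hX hU i,
    Finset.sum_congr rfl fun i hi =>
      integral_argminUpTo hX hindep hU (Finset.mem_Icc.1 hi).1]
  induction n with
  | zero => simp [harmonic_succ]
  | succ n ih =>
    rw [Finset.sum_Icc_succ_top (by omega), ih, harmonic_succ (n + 1)]
    push_cast
    rw [one_div]
    ring

end Uniform

/-! ### Expected number of hires -/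

/-- Probability that nobody is hired during a phase with threshold `2⁻ᵏ`. -/
noncomputable def phaseFailure (k : ℕ) : ℝ := (1 - (1 / 2) ^ k) ^ phaseLength k

/-- Expected number of hires from the start of a phase with threshold `2⁻ᵏ` until the threshold
drops below `2⁻ᵏ`. -/
noncomputable def expectedHires : ℕ → ℝ
  | 0 => 1
  | k + 1 => 2 * (1 - phaseFailure (k + 1) + phaseFailure (k + 1) * expectedHires k) /
      (2 - phaseFailure (k + 1))

/-- Expected number of further hires after the threshold has dropped below `2⁻ᵏ`, when the first
hire that lowers it to `2⁻ᴷ` or less is the last one. -/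
noncomputable def hiresBelow (K k : ℕ) : ℝ := 1 / 2 * ∑ j ∈ Finset.Ico (k + 1) K, expectedHires j

/-- Expected number of further hires from the start of a phase with threshold `2⁻ᵏ`. -/
noncomputable def hiresFrom (K k : ℕ) : ℝ := expectedHires k + hiresBelow K k

/-- Expected number of further hires when `t` steps with threshold `2⁻ᵏ` are left. -/
noncomputable def hiresWithin (K k t : ℕ) : ℝ :=
  (1 - (1 - (1 / 2) ^ k) ^ t) * (1 + hiresBelow K k) + (1 - (1 / 2) ^ k) ^ t * hiresFrom K (k - 1)

theorem half_pow_mem (k : ℕ) : 0 ≤ (1 / 2 : ℝ) ^ k ∧ (1 / 2 : ℝ) ^ k ≤ 1 :=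
  ⟨by positivity, pow_le_one₀ (by norm_num) (by norm_num)⟩

theorem phaseFailure_nonneg (k : ℕ) : 0 ≤ phaseFailure k :=
  pow_nonneg (sub_nonneg.2 (half_pow_mem k).2) _

/-- For k ≥ 2 the bound 1 - y ≤ exp(-y) gives exp(-3/4) ≈ 0.4724. The slightly larger constant is
what `expectedHires_le` can afford. -/
theorem phaseFailure_le (k : ℕ) : phaseFailure k ≤ 0.4739 := by
  rcases k with _ | _ | k
  · norm_num [phaseFailure, phaseLength]
  · norm_num [phaseFailure, phaseLength]
  · have h1 : 1 - (1 / 2 : ℝ) ^ (k + 2) ≤ Real.exp (-(1 / 2) ^ (k + 2)) := by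
      have := Real.add_one_le_exp (-(1 / 2 : ℝ) ^ (k + 2))
      linarith
    have h2 := pow_le_pow_left₀ (sub_nonneg.2 (half_pow_mem (k + 2)).2) h1 (3 * 2 ^ k)
    have h3 : ((3 * 2 ^ k : ℕ) : ℝ) * -(1 / 2) ^ (k + 2) = -(3 / 4) := by
      have : (2 : ℝ) ^ k * (1 / 2) ^ k = 1 := by rw [← mul_pow]; norm_num
      push_cast
      rw [pow_add]
      linear_combination -(3 / 4) * this
    rw [← Real.exp_nat_mul, h3, Real.exp_neg] at h2
    have h4 : (2.1147 : ℝ) ≤ Real.exp (3 / 4) := by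
      have := Real.sum_le_exp_of_nonneg (x := 3 / 4) (by norm_num) 5
      refine le_trans ?_ this
      norm_num [Finset.sum_range_succ, Nat.factorial]
    refine h2.trans ((inv_anti₀ (by norm_num) h4).trans (by norm_num))

theorem expectedHires_nonneg (k : ℕ) : 0 ≤ expectedHires k := by
  induction k with
  | zero => simp [expectedHires]
  | succ k ih =>
    have h0 := phaseFailure_nonneg (k + 1)
    have h1 := phaseFailure_le (k + 1)
    rw [expectedHires]
    have := mul_nonneg h0 ih
    exact div_nonneg (by linarith) (by linarith)

theorem expectedHires_succ_le {k : ℕ} {u v : ℝ} (h : expectedHires k ≤ v)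
    (huv : 2 * (1 - phaseFailure (k + 1) + phaseFailure (k + 1) * v) ≤
      u * (2 - phaseFailure (k + 1))) : expectedHires (k + 1) ≤ u := by
  have h0 := phaseFailure_nonneg (k + 1)
  have h1 := phaseFailure_le (k + 1)
  rw [expectedHires, div_le_iff₀ (by linarith)]
  have := mul_le_mul_of_nonneg_left h h0
  linarith

/-- The recursion preserves the bound 1.82 exactly when q ≤ 1.64/3.46 ≈ 0.47399. -/
theorem expectedHires_le (k : ℕ) : expectedHires k ≤ 1.82 := by
  induction k with
  | zero => norm_num [expectedHires]
  | succ k ih =>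
    have h1 := phaseFailure_le (k + 1)
    exact expectedHires_succ_le ih (by linarith)

theorem hiresBelow_nonneg (K k : ℕ) : 0 ≤ hiresBelow K k :=
  mul_nonneg (by norm_num) (Finset.sum_nonneg fun j _ => expectedHires_nonneg j)

theorem hiresBelow_le (K k : ℕ) : hiresBelow K k ≤ K := by
  have : ∑ j ∈ Finset.Ico (k + 1) K, expectedHires j ≤ ∑ j ∈ Finset.Ico (k + 1) K, 2 :=
    Finset.sum_le_sum fun j _ => (expectedHires_le j).trans (by norm_num)
  rw [Finset.sum_const, Nat.card_Ico, nsmul_eq_mul] at this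
  have h2 : ((K - (k + 1) : ℕ) : ℝ) ≤ K := by exact_mod_cast Nat.sub_le _ _
  rw [hiresBelow]
  linarith

theorem hiresBelow_of_le {K k : ℕ} (h : K ≤ k + 1) : hiresBelow K k = 0 := by
  rw [hiresBelow, Finset.Ico_eq_empty_of_le h, Finset.sum_empty, mul_zero]

theorem hiresBelow_of_lt {K k : ℕ} (h : k + 1 < K) :
    hiresBelow K k = 1 / 2 * expectedHires (k + 1) + hiresBelow K (k + 1) := by
  rw [hiresBelow, Finset.sum_eq_sum_Ico_succ_bot h, mul_add, hiresBelow]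

theorem hiresBelow_le_add (K k : ℕ) :
    hiresBelow K k ≤ 1 / 2 * expectedHires (k + 1) + hiresBelow K (k + 1) := by
  rcases Nat.lt_or_ge (k + 1) K with h | h
  · exact (hiresBelow_of_lt h).le
  · rw [hiresBelow_of_le h]
    have := expectedHires_nonneg (k + 1)
    have := hiresBelow_nonneg K (k + 1)
    positivity

theorem hiresFrom_nonneg (K k : ℕ) : 0 ≤ hiresFrom K k :=
  add_nonneg (expectedHires_nonneg k) (hiresBelow_nonneg K k)

theorem hiresWithin_zero (K k : ℕ) : hiresWithin K k 0 = hiresFrom K (k - 1) := by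
  simp [hiresWithin]

theorem hiresWithin_succ (K k t : ℕ) : hiresWithin K k (t + 1) =
    (1 / 2) ^ k * (1 + hiresBelow K k) + (1 - (1 / 2) ^ k) * hiresWithin K k t := by
  rw [hiresWithin, hiresWithin, pow_succ]
  ring

theorem hiresWithin_nonneg (K k t : ℕ) : 0 ≤ hiresWithin K k t := by
  have h := half_pow_mem k
  have h1 : (1 - (1 / 2 : ℝ) ^ k) ^ t ≤ 1 := pow_le_one₀ (by linarith) (by linarith)
  have h2 : 0 ≤ (1 - (1 / 2 : ℝ) ^ k) ^ t := pow_nonneg (by linarith) _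
  have := hiresBelow_nonneg K k
  exact add_nonneg (mul_nonneg (by linarith) (by linarith)) (mul_nonneg h2 (hiresFrom_nonneg _ _))

theorem hiresWithin_le (K k t : ℕ) : hiresWithin K k t ≤ 2 + K := by
  have h := half_pow_mem k
  have h1 : (1 - (1 / 2 : ℝ) ^ k) ^ t ≤ 1 := pow_le_one₀ (by linarith) (by linarith)
  have h2 : 0 ≤ (1 - (1 / 2 : ℝ) ^ k) ^ t := pow_nonneg (by linarith) _
  have h3 : 1 + hiresBelow K k ≤ 2 + K := by linarith [hiresBelow_le K k]
  have h4 : hiresFrom K (k - 1) ≤ 2 + K :=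
    add_le_add ((expectedHires_le _).trans (by norm_num)) (hiresBelow_le _ _)
  have h5 := mul_le_mul_of_nonneg_left h3 (sub_nonneg.2 h1)
  have h6 := mul_le_mul_of_nonneg_left h4 h2
  rw [hiresWithin]
  linarith

/-- The recursion for `expectedHires` is made for this. It is only an inequality because
`hiresBelow` no longer counts levels from `K` on. -/
theorem hiresWithin_phaseLength_le (K k : ℕ) : hiresWithin K k (phaseLength k) ≤ hiresFrom K k := by
  rcases k with _ | k
  · simp [hiresWithin, phaseLength, hiresFrom, expectedHires]
  · have h0 := phaseFailure_nonneg (k + 1)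
    have h1 := phaseFailure_le (k + 1)
    have h2 := mul_le_mul_of_nonneg_left (hiresBelow_le_add K k) h0
    have h3 : expectedHires (k + 1) * (2 - phaseFailure (k + 1)) =
        2 * (1 - phaseFailure (k + 1) + phaseFailure (k + 1) * expectedHires k) := by
      rw [expectedHires, div_mul_cancel₀ _ (by linarith)]
    rw [hiresWithin, ← phaseFailure, hiresFrom, hiresFrom, Nat.add_sub_cancel]
    linarith

/-- Both sides average the further hires over the level j of a cost at most 2⁻ᵏ; level j has
probability 2⁻ʲ, and each next level is hit with conditional probability 1/2. -/
theorem sum_half_pow_mul_hiresFrom (K k : ℕ) :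
    ∑ j ∈ Finset.Ico (k + 1) K, (1 / 2 : ℝ) ^ j * hiresFrom K j = (1 / 2) ^ k * hiresBelow K k := by
  rcases Nat.lt_or_ge (k + 1) K with h | h
  · rw [Finset.sum_eq_sum_Ico_succ_bot h, sum_half_pow_mul_hiresFrom K (k + 1),
      hiresBelow_of_lt h, hiresFrom, pow_succ]
    ring
  · rw [hiresBelow_of_le h, Finset.Ico_eq_empty_of_le h, Finset.sum_empty, mul_zero]
termination_by K - k

/-! ### Numerical comparison with harmonic numbers -/

theorem harmonic_mono : Monotone harmonic :=
  monotone_nat_of_le_succ fun n => by rw [harmonic_succ]; simp; positivity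

theorem expectedHires_le_of_le_seven : expectedHires 1 ≤ 1.1429 ∧ expectedHires 2 ≤ 1.3438 ∧
    expectedHires 3 ≤ 1.4883 ∧ expectedHires 4 ≤ 1.5922 ∧ expectedHires 5 ≤ 1.665 ∧
    expectedHires 6 ≤ 1.715 ∧ expectedHires 7 ≤ 1.7486 := by
  have h0 : expectedHires 0 ≤ 1 := le_refl 1
  have h1 : expectedHires 1 ≤ 1.1429 :=
    expectedHires_succ_le h0 (by norm_num [phaseFailure, phaseLength])
  have h2 : expectedHires 2 ≤ 1.3438 :=
    expectedHires_succ_le h1 (by norm_num [phaseFailure, phaseLength])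
  have h3 : expectedHires 3 ≤ 1.4883 :=
    expectedHires_succ_le h2 (by norm_num [phaseFailure, phaseLength])
  have h4 : expectedHires 4 ≤ 1.5922 :=
    expectedHires_succ_le h3 (by norm_num [phaseFailure, phaseLength])
  have h5 : expectedHires 5 ≤ 1.665 :=
    expectedHires_succ_le h4 (by norm_num [phaseFailure, phaseLength])
  have h6 : expectedHires 6 ≤ 1.715 :=
    expectedHires_succ_le h5 (by norm_num [phaseFailure, phaseLength])
  have h7 : expectedHires 7 ≤ 1.7486 :=
    expectedHires_succ_le h6 (by norm_num [phaseFailure, phaseLength])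
  exact ⟨h1, h2, h3, h4, h5, h6, h7⟩

/-- Bound on the expected number of hires if hires of level at least `K` (at least `L` in the first
step) are final. -/
noncomputable def totalHires (K L : ℕ) : ℝ :=
  1 + ∑ j ∈ Finset.Ico 1 L, (1 / 2 : ℝ) ^ j * hiresFrom K j

theorem totalHires_self (K : ℕ) :
    totalHires K K = 1 + 1 / 2 * ∑ j ∈ Finset.Ico 1 K, expectedHires j := by
  rw [totalHires, sum_half_pow_mul_hiresFrom K 0, hiresBelow, pow_zero, one_mul]

theorem totalHires_succ_self {K : ℕ} (hK : 1 ≤ K) :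
    totalHires (K + 1) (K + 1) = totalHires K K + 1 / 2 * expectedHires K := by
  rw [totalHires_self, totalHires_self, Finset.sum_Ico_succ_top hK]
  ring

theorem totalHires_succ {K : ℕ} (hK : 1 ≤ K) :
    totalHires K (K + 1) = totalHires K K + (1 / 2) ^ K * expectedHires K := by
  rw [totalHires, Finset.sum_Ico_succ_top hK, totalHires, hiresFrom, hiresBelow_of_le (by omega)]
  ring

theorem harmonic_ge_of_le {m n : ℕ} {q : ℚ} (hq : q ≤ harmonic m) (h : m ≤ n) :
    (q : ℝ) ≤ ((harmonic n : ℚ) : ℝ) := by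
  exact_mod_cast hq.trans (harmonic_mono h)

/-- The sequence H_n - log(n+1), which tends to the Euler–Mascheroni constant, is increasing. -/
theorem harmonic_add_log_le {m n : ℕ} (h : m ≤ n) :
    ((harmonic m : ℚ) : ℝ) + (Real.log (n + 1) - Real.log (m + 1)) ≤ ((harmonic n : ℚ) : ℝ) := by
  have := Real.strictMono_eulerMascheroniSeq.monotone h
  rw [Real.eulerMascheroniSeq, Real.eulerMascheroniSeq] at this
  linarith

set_option maxRecDepth 4000 in
theorem harmonic_194_ge : (5.8476 : ℚ) ≤ harmonic 194 := by
  norm_num [harmonic, Finset.sum_range_succ]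

set_option maxRecDepth 4000 in
theorem harmonic_ge_of_le_98 : (1.833 : ℚ) ≤ harmonic 3 ∧ (2.283 : ℚ) ≤ harmonic 5 ∧
    (2.717 : ℚ) ≤ harmonic 8 ∧ (3.251 : ℚ) ≤ harmonic 14 ∧ (3.318 : ℚ) ≤ harmonic 15 ∧
    (3.854 : ℚ) ≤ harmonic 26 ∧ (3.891 : ℚ) ≤ harmonic 27 ∧ (4.499 : ℚ) ≤ harmonic 50 ∧
    (4.518 : ℚ) ≤ harmonic 51 ∧ (5.167 : ℚ) ≤ harmonic 98 := by
  norm_num [harmonic, Finset.sum_range_succ]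

theorem totalHires_self_le : totalHires 1 1 = 1 ∧ totalHires 2 2 ≤ 1.57145 ∧
    totalHires 3 3 ≤ 2.24335 ∧ totalHires 4 4 ≤ 2.9875 ∧ totalHires 5 5 ≤ 3.7836 ∧
    totalHires 6 6 ≤ 4.6161 ∧ totalHires 7 7 ≤ 5.4736 ∧ totalHires 8 8 ≤ 6.3479 := by
  obtain ⟨h1, h2, h3, h4, h5, h6, h7⟩ := expectedHires_le_of_le_seven
  have e1 : totalHires 1 1 = 1 := by simp [totalHires_self]
  have e2 := totalHires_succ_self (K := 1) (by norm_num)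
  have e3 := totalHires_succ_self (K := 2) (by norm_num)
  have e4 := totalHires_succ_self (K := 3) (by norm_num)
  have e5 := totalHires_succ_self (K := 4) (by norm_num)
  have e6 := totalHires_succ_self (K := 5) (by norm_num)
  have e7 := totalHires_succ_self (K := 6) (by norm_num)
  have e8 := totalHires_succ_self (K := 7) (by norm_num)
  norm_num1 at *
  refine ⟨e1, ?_, ?_, ?_, ?_, ?_, ?_, ?_⟩ <;> linarith

/-- Compare with K = 8, n = 193: each further level costs at most (9/4)·(1.82/2) = 2.0475, and the
harmonic side gains at least 2.965·0.693 > 2.054. The base case leaves room for replacing log 195 by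
log 192. -/
theorem totalHires_le_of_large {K n : ℕ} (hK : 8 ≤ K) (hn : 3 * 2 ^ (K - 2) < n) :
    9 / 4 * totalHires K K ≤ 2.965 * (((harmonic (n + 1) : ℚ) : ℝ) - 1) := by
  obtain ⟨m, rfl⟩ := Nat.exists_eq_add_of_le hK
  have h8 := totalHires_self_le.2.2.2.2.2.2.2
  have hS : totalHires (8 + m) (8 + m) ≤ totalHires 8 8 + 0.91 * m := by
    have hb : ∑ j ∈ Finset.Ico 8 (8 + m), expectedHires j ≤ ∑ j ∈ Finset.Ico 8 (8 + m), 1.82 :=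
      Finset.sum_le_sum fun j _ => expectedHires_le j
    rw [Finset.sum_const, Nat.card_Ico, nsmul_eq_mul, Nat.add_sub_cancel_left] at hb
    rw [totalHires_self, totalHires_self,
      ← Finset.sum_Ico_consecutive _ (by norm_num : 1 ≤ 8) (by omega : 8 ≤ 8 + m)]
    linarith
  have hp : 8 + m - 2 = m + 6 := by omega
  rw [hp] at hn
  have h1m := Nat.one_le_two_pow (n := m)
  have hn' : 192 * 2 ^ m < n := by
    rw [pow_add] at hn
    omega
  have hH := harmonic_add_log_le (m := 194) (n := n + 1) (by omega)
  have h194 : (5.8476 : ℝ) ≤ ((harmonic 194 : ℚ) : ℝ) := by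
    have := harmonic_ge_of_le harmonic_194_ge le_rfl
    rwa [show ((5.8476 : ℚ) : ℝ) = 5.8476 by norm_num] at this
  have hlog : Real.log 192 + m * Real.log 2 ≤ Real.log ((n + 1 : ℕ) + 1) := by
    rw [← Real.log_pow, ← Real.log_mul (by norm_num) (by positivity)]
    refine Real.log_le_log (by positivity) ?_
    have : ((192 * 2 ^ m : ℕ) : ℝ) ≤ n := by exact_mod_cast hn'.le
    push_cast at this ⊢
    linarith
  have hq : Real.log 195 - Real.log 192 ≤ 3 / 192 := by
    rw [← Real.log_div (by norm_num) (by norm_num)]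
    have := Real.log_le_sub_one_of_pos (x := 195 / 192) (by norm_num)
    linarith
  have h2l := Real.log_two_gt_d9
  have hml : (m : ℝ) * 0.693 ≤ m * Real.log 2 :=
    mul_le_mul_of_nonneg_left (by linarith) (Nat.cast_nonneg m)
  have hc : ((194 : ℕ) : ℝ) + 1 = 195 := by norm_num
  rw [hc] at hH
  have hm0 : (0 : ℝ) ≤ m := Nat.cast_nonneg m
  linarith

/-- On each range of n the harmonic number is taken at the left end. For n = 13, 25, 49, one more
than a contract length, K = L would be too expensive with these bounds. There only the first step
needs the larger level L = K + 1, since from step 2 on a contract of level K already passes the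
horizon. -/
theorem totalHires_le_of_small {n : ℕ} (hn : 2 ≤ n) (hn' : n ≤ 192) :
    ∃ K L : ℕ, n ≤ contractLength K + 1 ∧ n ≤ contractLength L ∧
      9 / 4 * totalHires K L ≤ 2.965 * (((harmonic (n + 1) : ℚ) : ℝ) - 1) := by
  obtain ⟨h1, h2, h3, h4, h5, h6, h7⟩ := expectedHires_le_of_le_seven
  have key : ∀ (K L m : ℕ) (q : ℚ), q ≤ harmonic (m + 1) → m ≤ n → n ≤ contractLength K + 1 →
      n ≤ contractLength L → 9 / 4 * totalHires K L ≤ 2.965 * ((q : ℝ) - 1) →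
      ∃ K L : ℕ, n ≤ contractLength K + 1 ∧ n ≤ contractLength L ∧
        9 / 4 * totalHires K L ≤ 2.965 * (((harmonic (n + 1) : ℚ) : ℝ) - 1) := by
    intro K L m q hq hmn hK hL h
    refine ⟨K, L, hK, hL, h.trans ?_⟩
    have := harmonic_ge_of_le hq (by omega : m + 1 ≤ n + 1)
    linarith
  obtain ⟨t1, t2, t3, t4, t5, t6, t7, -⟩ := totalHires_self_le
  have u3 := totalHires_succ (K := 3) (by norm_num)
  have u4 := totalHires_succ (K := 4) (by norm_num)
  have u5 := totalHires_succ (K := 5) (by norm_num)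
  obtain ⟨g3, g5, g8, g14, g15, g26, g27, g50, g51, g98⟩ := harmonic_ge_of_le_98
  rcases Nat.lt_or_ge n 4 with c | c
  · exact key 1 1 2 _ g3 hn (by norm_num [contractLength]; omega)
      (by norm_num [contractLength]; omega) (by norm_num1 at *; linarith)
  rcases Nat.lt_or_ge n 7 with c' | c'
  · exact key 2 2 4 _ g5 c (by norm_num [contractLength]; omega)
      (by norm_num [contractLength]; omega) (by norm_num1 at *; linarith)
  rcases Nat.lt_or_ge n 13 with d | d
  · exact key 3 3 7 _ g8 c' (by norm_num [contractLength]; omega)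
      (by norm_num [contractLength]; omega) (by norm_num1 at *; linarith)
  rcases Nat.lt_or_ge n 14 with d' | d'
  · exact key 3 4 13 _ g14 d (by norm_num [contractLength]; omega)
      (by norm_num [contractLength]; omega) (by norm_num1 at *; linarith)
  rcases Nat.lt_or_ge n 25 with e | e
  · exact key 4 4 14 _ g15 d' (by norm_num [contractLength]; omega)
      (by norm_num [contractLength]; omega) (by norm_num1 at *; linarith)
  rcases Nat.lt_or_ge n 26 with e' | e'
  · exact key 4 5 25 _ g26 e (by norm_num [contractLength]; omega)
      (by norm_num [contractLength]; omega) (by norm_num1 at *; linarith)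
  rcases Nat.lt_or_ge n 49 with f | f
  · exact key 5 5 26 _ g27 e' (by norm_num [contractLength]; omega)
      (by norm_num [contractLength]; omega) (by norm_num1 at *; linarith)
  rcases Nat.lt_or_ge n 50 with f' | f'
  · exact key 5 6 49 _ g50 f (by norm_num [contractLength]; omega)
      (by norm_num [contractLength]; omega) (by norm_num1 at *; linarith)
  rcases Nat.lt_or_ge n 97 with g | g
  · exact key 6 6 50 _ g51 f' (by norm_num [contractLength]; omega)
      (by norm_num [contractLength]; omega) (by norm_num1 at *; linarith)
  · exact key 7 7 97 _ g98 g (by norm_num [contractLength]; omega)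
      (by norm_num [contractLength]; omega) (by norm_num1 at *; linarith)

theorem exists_totalHires_le {n : ℕ} (hn : 2 ≤ n) :
    ∃ K L : ℕ, n ≤ contractLength K + 1 ∧ n ≤ contractLength L ∧
      9 / 4 * totalHires K L ≤ 2.965 * (((harmonic (n + 1) : ℚ) : ℝ) - 1) := by
  rcases Nat.lt_or_ge 192 n with h | h
  -- The least such m gives K = L = m + 1; its minimality provides the lower bound on n.
  · have hex : ∃ m : ℕ, n ≤ 3 * 2 ^ m := ⟨n, (Nat.lt_two_pow_self).le.trans (by omega)⟩
    have hspec := Nat.find_spec hex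
    set m := Nat.find hex with hm
    have h7 : 7 ≤ m := by
      by_contra! hlt
      have : (2 : ℕ) ^ m ≤ 2 ^ 6 := Nat.pow_le_pow_right (by norm_num) (by omega)
      omega
    have hmin : ¬ n ≤ 3 * 2 ^ (m - 1) := Nat.find_min hex (by omega)
    refine ⟨m + 1, m + 1, ?_, ?_, totalHires_le_of_large (by omega) (not_le.1 hmin)⟩ <;>
      rw [contractLength_succ] <;> omega
  · exact totalHires_le_of_small hn h

/-! ### Measurability; the state space is countable and discrete -/

instance : MeasurableSpace (Option (ℕ × ℕ)) := ⊤

instance : DiscreteMeasurableSpace (Option (ℕ × ℕ)) := ⟨fun _ => trivial⟩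

theorem measurable_level : Measurable level := by
  refine measurable_of_Iic fun j => ?_
  have : level ⁻¹' Set.Iic j = Set.Iic 0 ∪ Set.Ioi ((1 / 2 : ℝ) ^ j) := by
    ext x
    rw [Set.mem_preimage, Set.mem_Iic, Set.mem_union, Set.mem_Iic, Set.mem_Ioi]
    rcases le_or_gt x 0 with hx | hx
    · have he : {j : ℕ | (1 / 2 : ℝ) ^ j < x} = ∅ := by
        ext m
        simpa using hx.trans (by positivity)
      rw [level, he, Nat.sInf_empty]
      simp [hx]
    · rw [level_le_iff hx]
      simp [hx]
  rw [this]
  exact measurableSet_Iic.union measurableSet_Ioi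

theorem measurable_nextPhase (n i : ℕ) :
    Measurable fun p : Option (ℕ × ℕ) × ℝ => nextPhase n i p.1 p.2 := by
  refine measurable_from_prod_countable_right fun d => ?_
  rcases d with _ | ⟨k, t⟩
  · exact measurable_const
  · exact Measurable.ite measurableSet_Iic
      ((Measurable.of_discrete (f := fun j => if n < i + contractLength j then none
        else some (j, phaseLength j - 1))).comp measurable_level) measurable_const

theorem measurable_duration : Measurable fun p : Option (ℕ × ℕ) × ℝ => duration p.1 p.2 := by
  refine measurable_from_prod_countable_right fun d => ?_
  rcases d with _ | ⟨k, t⟩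
  · exact measurable_const
  · exact Measurable.ite measurableSet_Iic
      ((Measurable.of_discrete (f := contractLength)).comp measurable_level) measurable_const

theorem duration_mul_mem (d : Option (ℕ × ℕ)) {x : ℝ} (hx : 0 < x) :
    0 ≤ (duration d x : ℝ) * x ∧ (duration d x : ℝ) * x ≤ 3 := by
  refine ⟨by positivity, ?_⟩
  rcases d with _ | ⟨k, t⟩
  · simp [duration]
  · rw [duration]
    split_ifs with h
    · obtain ⟨j, hj⟩ : ∃ j, level x = j + 1 :=
        ⟨level x - 1, by have := (lt_level_iff hx k).2 h; omega⟩
      have hxj : x ≤ (1 / 2 : ℝ) ^ j := (lt_level_iff hx j).1 (by omega)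
      have h2 : (2 : ℝ) ^ j * (1 / 2) ^ j = 1 := by rw [← mul_pow]; norm_num
      rw [hj, contractLength_succ]
      push_cast
      have := mul_le_mul_of_nonneg_left hxj (by positivity : (0 : ℝ) ≤ 3 * 2 ^ j)
      linarith
    · simp

/-! ### The potential and its one-step inequality -/

/-- Bound on the expected future cost in a given state, if hires of level at least `K` (at least
`L` in the next step) are final. -/
noncomputable def costBound (K L : ℕ) : Option (ℕ × ℕ) → ℝ
  | none => 0
  | some (k, t) => 9 / 4 * ((1 / 2) ^ k + ∑ j ∈ Finset.Ico (k + 1) L, (1 / 2) ^ j * hiresFrom K j +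
      (1 - (1 / 2) ^ k) * hiresWithin K k t)

theorem costBound_self (K k t : ℕ) :
    costBound K K (some (k, t)) = 9 / 4 * hiresWithin K k (t + 1) := by
  rw [costBound, sum_half_pow_mul_hiresFrom, hiresWithin_succ]
  ring

theorem costBound_init (K L : ℕ) : costBound K L (some (0, 0)) = 9 / 4 * totalHires K L := by
  rw [costBound, totalHires]
  simp

theorem costBound_self_mem (K : ℕ) (d : Option (ℕ × ℕ)) :
    0 ≤ costBound K K d ∧ costBound K K d ≤ 9 / 4 * (2 + K) := by
  rcases d with _ | ⟨k, t⟩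
  · exact ⟨le_rfl, by rw [costBound]; positivity⟩
  · rw [costBound_self]
    have h1 := hiresWithin_nonneg K k (t + 1)
    have h2 := hiresWithin_le K k (t + 1)
    constructor <;> linarith

theorem costBound_phaseLength_le (K k : ℕ) :
    costBound K K (some (k, phaseLength k - 1)) ≤ 9 / 4 * hiresFrom K k := by
  have := phaseLength_pos k
  rw [costBound_self, Nat.sub_add_cancel this]
  linarith [hiresWithin_phaseLength_le K k]

/-- Cost incurred in a step plus the bound on the future cost after it. -/
noncomputable def stepCost (K n i : ℕ) (d : Option (ℕ × ℕ)) (x : ℝ) : ℝ :=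
  duration d x * x + costBound K K (nextPhase n i d x)

theorem measurable_stepCost (K n i : ℕ) :
    Measurable fun p : Option (ℕ × ℕ) × ℝ => stepCost K n i p.1 p.2 :=
  ((Measurable.of_discrete (f := fun m : ℕ => (m : ℝ))).comp measurable_duration |>.mul
    measurable_snd).add ((Measurable.of_discrete (f := costBound K K)).comp
      (measurable_nextPhase n i))

theorem stepCost_mem (K n i : ℕ) (d : Option (ℕ × ℕ)) {x : ℝ} (hx : 0 < x) :
    0 ≤ stepCost K n i d x ∧ stepCost K n i d x ≤ 3 + 9 / 4 * (2 + K) := by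
  have h1 := duration_mul_mem d hx
  have h2 := costBound_self_mem K (nextPhase n i d x)
  rw [stepCost]
  constructor <;> linarith

/-- Finitely many dyadic pieces plus a remainder near 0 bounded by `C` avoid an infinite series; the
remainder vanishes as `m` grows. -/
theorem integral_le_sum_dyadic {g : ℝ → ℝ} {C : ℝ} (hg : IntervalIntegrable g volume 0 1)
    (hC : ∀ x, 0 < x → x ≤ 1 → g x ≤ C) {b : ℕ → ℝ} {k : ℕ}
    (hb : ∀ j, k ≤ j → ∫ x in ((1 / 2 : ℝ) ^ (j + 1))..(1 / 2) ^ j, g x ≤ b j) (m : ℕ) :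
    ∫ x in (0 : ℝ)..(1 / 2) ^ k, g x ≤
      ∑ j ∈ Finset.Ico k (k + m), b j + C * (1 / 2) ^ (k + m) := by
  have hint : ∀ i j : ℕ, IntervalIntegrable g volume ((1 / 2 : ℝ) ^ i) ((1 / 2) ^ j) :=
    fun i j => hg.mono_set (Set.uIcc_subset_uIcc
      (by rw [Set.uIcc_of_le zero_le_one]; exact half_pow_mem i)
      (by rw [Set.uIcc_of_le zero_le_one]; exact half_pow_mem j))
  have hint0 : ∀ j : ℕ, IntervalIntegrable g volume 0 ((1 / 2) ^ j) :=
    fun j => hg.mono_set (Set.uIcc_subset_uIcc Set.left_mem_uIcc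
      (by rw [Set.uIcc_of_le zero_le_one]; exact half_pow_mem j))
  have hsplit : ∫ x in (0 : ℝ)..(1 / 2) ^ k, g x =
      ∑ j ∈ Finset.Ico k (k + m), (∫ x in ((1 / 2 : ℝ) ^ (j + 1))..(1 / 2) ^ j, g x) +
        ∫ x in (0 : ℝ)..(1 / 2) ^ (k + m), g x := by
    induction m with
    | zero => simp
    | succ m ih =>
      rw [ih, ← intervalIntegral.integral_add_adjacent_intervals (hint0 (k + m + 1))
        (hint (k + m + 1) (k + m)), ← add_assoc k m 1, Finset.sum_Ico_succ_top (by omega)]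
      ring
  have hlast := intervalIntegral.integral_mono_on_of_le_Ioo (half_pow_mem (k + m)).1
    (hint0 (k + m)) (intervalIntegrable_const (c := C))
    (fun x hx => hC x hx.1 (hx.2.le.trans (half_pow_mem (k + m)).2))
  rw [intervalIntegral.integral_const, smul_eq_mul, sub_zero] at hlast
  rw [hsplit, mul_comm C]
  exact add_le_add (Finset.sum_le_sum fun j hj => hb j (Finset.mem_Ico.1 hj).1) hlast

theorem intervalIntegrable_stepCost (K n i : ℕ) (d : Option (ℕ × ℕ)) :
    IntervalIntegrable (stepCost K n i d) volume 0 1 := by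
  rw [intervalIntegrable_iff_integrableOn_Ioc_of_le zero_le_one]
  refine integrable_of_ae_le ((measurable_stepCost K n i).comp
    (measurable_const.prodMk measurable_id)).aestronglyMeasurable (3 + 9 / 4 * (2 + K)) ?_
  filter_upwards [ae_restrict_mem measurableSet_Ioc] with x hx
  exact stepCost_mem K n i d hx.1

theorem contractLength_mono : Monotone contractLength := fun _ _ h =>
  Nat.mul_le_mul_left 3 (Nat.pow_le_pow_right (by norm_num) (Nat.sub_le_sub_right h 1))

/-- On a dyadic interval the level, hence the contract and the next state, is constant. A final hire
leaves potential 0; levels from `L` on are always final, and treating lower levels as non-final only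
increases the bound. -/
theorem integral_stepCost_dyadic_le {K L n i k t j : ℕ} (hL : n < i + contractLength L)
    (hkj : k ≤ j) :
    ∫ x in ((1 / 2 : ℝ) ^ (j + 1))..(1 / 2) ^ j, stepCost K n i (some (k, t)) x ≤
      9 / 4 * ((1 / 2) ^ (j + 1) *
        (1 + if j + 1 < L then hiresFrom K (j + 1) else 0)) := by
  set c : ℝ := if j + 1 < L then hiresFrom K (j + 1) else 0 with hc
  have hc0 : 0 ≤ c := by
    rw [hc]
    split_ifs
    · exact hiresFrom_nonneg _ _
    · exact le_rfl
  have hle : (1 / 2 : ℝ) ^ (j + 1) ≤ (1 / 2) ^ j :=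
    pow_le_pow_of_le_one (by norm_num) (by norm_num) (Nat.le_succ j)
  have hbound : ∀ x ∈ Set.Ioo ((1 / 2 : ℝ) ^ (j + 1)) ((1 / 2) ^ j),
      stepCost K n i (some (k, t)) x ≤ 3 * 2 ^ j * x + 9 / 4 * c := by
    intro x hx
    have hlev : level x = j + 1 := level_eq ⟨hx.1, hx.2.le⟩
    have hxk : x ≤ (1 / 2 : ℝ) ^ k :=
      hx.2.le.trans (pow_le_pow_of_le_one (by norm_num) (by norm_num) hkj)
    rw [stepCost, duration, nextPhase, if_pos hxk, if_pos hxk, hlev, contractLength_succ]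
    push_cast
    refine add_le_add le_rfl ?_
    split_ifs with h
    · rw [costBound]
      positivity
    · have hjL : j + 1 < L := by
        by_contra! hj
        have := contractLength_mono hj
        rw [contractLength_succ] at this
        omega
      rw [hc, if_pos hjL]
      exact costBound_phaseLength_le K (j + 1)
  have hsub : Set.uIcc ((1 / 2 : ℝ) ^ (j + 1)) ((1 / 2) ^ j) ⊆ Set.uIcc 0 1 :=
    Set.uIcc_subset_uIcc (by rw [Set.uIcc_of_le zero_le_one]; exact half_pow_mem _)
      (by rw [Set.uIcc_of_le zero_le_one]; exact half_pow_mem _)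
  have hlin : IntervalIntegrable (fun x : ℝ => 3 * 2 ^ j * x) volume
      ((1 / 2 : ℝ) ^ (j + 1)) ((1 / 2) ^ j) :=
    (continuous_const.mul continuous_id).intervalIntegrable _ _
  refine (intervalIntegral.integral_mono_on_of_le_Ioo hle
    ((intervalIntegrable_stepCost K n i _).mono_set hsub)
    (hlin.add intervalIntegrable_const) hbound).trans ?_
  rw [intervalIntegral.integral_add hlin intervalIntegrable_const,
    intervalIntegral.integral_const_mul, integral_id, intervalIntegral.integral_const, smul_eq_mul]
  have h2 : (2 : ℝ) ^ j * (1 / 2) ^ j = 1 := by rw [← mul_pow]; norm_num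
  -- The source of 9/4: the integral of 3·2ʲ·x over the interval is (9/8)·2⁻ʲ = (9/4)·2⁻⁽ʲ⁺¹⁾.
  refine le_of_eq ?_
  rw [pow_succ]
  linear_combination (9 / 8) * (1 / 2 : ℝ) ^ j * h2

theorem integral_stepCost_hire_le {K L n i k t : ℕ} (hL : n < i + contractLength L) :
    ∫ x in (0 : ℝ)..(1 / 2) ^ k, stepCost K n i (some (k, t)) x ≤
      9 / 4 * ((1 / 2) ^ k + ∑ j ∈ Finset.Ico (k + 1) L, (1 / 2) ^ j * hiresFrom K j) := by
  have hlim : Filter.Tendsto (fun m : ℕ =>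
      9 / 4 * ((1 / 2) ^ k + ∑ j ∈ Finset.Ico (k + 1) L, (1 / 2) ^ j * hiresFrom K j) +
        (3 + 9 / 4 * (2 + K)) * (1 / 2 : ℝ) ^ (k + m)) Filter.atTop
      (nhds (9 / 4 * ((1 / 2) ^ k +
        ∑ j ∈ Finset.Ico (k + 1) L, (1 / 2) ^ j * hiresFrom K j) + (3 + 9 / 4 * (2 + K)) * 0)) := by
    refine tendsto_const_nhds.add (Filter.Tendsto.const_mul _ ?_)
    have := tendsto_pow_atTop_nhds_zero_of_lt_one (r := (1 / 2 : ℝ)) (by norm_num) (by norm_num)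
    exact this.comp (Filter.tendsto_atTop_mono (fun m => Nat.le_add_left m k) Filter.tendsto_id)
  rw [mul_zero, add_zero] at hlim
  refine ge_of_tendsto' hlim fun m => ?_
  refine (integral_le_sum_dyadic (intervalIntegrable_stepCost K n i _)
    (fun x h0 _ => (stepCost_mem K n i _ h0).2)
    (fun j hj => integral_stepCost_dyadic_le hL hj) m).trans (add_le_add ?_ le_rfl)
  rw [← Finset.mul_sum]
  refine mul_le_mul_of_nonneg_left ?_ (by norm_num)
  simp only [mul_add, mul_one, Finset.sum_add_distrib]
  refine add_le_add ?_ ?_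
  · have : ∀ m : ℕ, ∑ j ∈ Finset.Ico k (k + m), (1 / 2 : ℝ) ^ (j + 1) =
        (1 / 2) ^ k - (1 / 2) ^ (k + m) := by
      intro m
      induction m with
      | zero => simp
      | succ m ih =>
        rw [← add_assoc, Finset.sum_Ico_succ_top (by omega), ih, pow_succ _ (k + m)]
        ring
    rw [this]
    linarith [(half_pow_mem (k + m)).1]
  · rw [Finset.sum_Ico_add' (fun j => (1 / 2 : ℝ) ^ j * if j < L then hiresFrom K j else 0)]
    simp only [mul_ite, mul_zero]
    rw [← Finset.sum_filter]
    refine Finset.sum_le_sum_of_subset_of_nonneg (fun j hj => ?_)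
      fun j _ _ => mul_nonneg (half_pow_mem j).1 (hiresFrom_nonneg K j)
    rw [Finset.mem_filter, Finset.mem_Ico] at hj
    exact Finset.mem_Ico.2 ⟨hj.1.1, hj.2⟩

/-- The supermartingale property. Costs up to 2⁻ᵏ lead to a hire; the remaining 1 - 2⁻ᵏ only
shortens the phase or moves to the preceding one. -/
theorem integral_stepCost_le (K : ℕ) {L n i : ℕ} (hL : n < i + contractLength L)
    (d : Option (ℕ × ℕ)) : ∫ x in (0 : ℝ)..1, stepCost K n i d x ≤ costBound K L d := by
  rcases d with _ | ⟨k, t⟩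
  · simp [stepCost, duration, nextPhase, costBound]
  have hmem : (1 / 2 : ℝ) ^ k ∈ Set.uIcc (0 : ℝ) 1 := by
    rw [Set.uIcc_of_le zero_le_one]
    exact half_pow_mem k
  have hint := intervalIntegrable_stepCost K n i (some (k, t))
  have h1 := hint.mono_set (Set.uIcc_subset_uIcc Set.left_mem_uIcc hmem)
  have h2 := hint.mono_set (Set.uIcc_subset_uIcc hmem Set.right_mem_uIcc)
  rw [← intervalIntegral.integral_add_adjacent_intervals h1 h2, costBound, mul_add]
  refine add_le_add (integral_stepCost_hire_le hL) ?_
  have hfail : ∀ x ∈ Set.Ioo ((1 / 2 : ℝ) ^ k) 1,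
      stepCost K n i (some (k, t)) x ≤ 9 / 4 * hiresWithin K k t := by
    intro x hx
    rw [stepCost, duration, nextPhase, if_neg (not_le.2 hx.1), if_neg (not_le.2 hx.1),
      Nat.cast_zero, zero_mul, zero_add]
    split_ifs with ht
    · rw [ht, hiresWithin_zero]
      exact costBound_phaseLength_le K (k - 1)
    · rw [costBound_self, Nat.sub_add_cancel (by omega)]
  have := intervalIntegral.integral_mono_on_of_le_Ioo (half_pow_mem k).2 h2
    intervalIntegrable_const hfail
  rw [intervalIntegral.integral_const, smul_eq_mul] at this
  linarith

/-! ### Independence of the state and the next cost -/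

section ExpectedCost

variable {Ω : Type*} [MeasurableSpace Ω]

/-- Fubini for the product law of state and next cost turns the pointwise inequality in the state
into one of expectations. -/
theorem integral_le_of_indepFun {P : Measure Ω} [IsProbabilityMeasure P] {S : Type*}
    [MeasurableSpace S] {D : Ω → S} {Y : Ω → ℝ} (hD : Measurable D) (hY : Measurable Y)
    (hU : pdf.IsUniform Y (Set.Icc (0 : ℝ) 1) P volume) (hDY : IndepFun D Y P)
    {F : S → ℝ → ℝ} (hF : Measurable fun p : S × ℝ => F p.1 p.2) {C : ℝ}
    (hFC : ∀ d x, 0 < x → x ≤ 1 → 0 ≤ F d x ∧ F d x ≤ C) {G : S → ℝ}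
    (hG : Integrable (fun ω => G (D ω)) P) (hGm : Measurable G)
    (hFG : ∀ d, ∫ x in (0 : ℝ)..1, F d x ≤ G d) :
    Integrable (fun ω => F (D ω) (Y ω)) P ∧ ∫ ω, F (D ω) (Y ω) ∂P ≤ ∫ ω, G (D ω) ∂P := by
  have hDYm : Measurable fun ω => (D ω, Y ω) := hD.prodMk hY
  have hFint : Integrable (fun ω => F (D ω) (Y ω)) P := by
    refine integrable_of_ae_le (hF.comp hDYm).aestronglyMeasurable C ?_
    filter_upwards [ae_mem_Ioc_of_isUniform hY hU] with ω hω
    exact hFC _ _ hω.1 hω.2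
  refine ⟨hFint, ?_⟩
  have hprod := (indepFun_iff_map_prod_eq_prod_map_map hD.aemeasurable hY.aemeasurable).1 hDY
  have hFint' : Integrable (fun p : S × ℝ => F p.1 p.2) ((P.map D).prod (P.map Y)) := by
    rw [← hprod]
    exact (integrable_map_measure hF.aestronglyMeasurable hDYm.aemeasurable).2 hFint
  have h1 : ∫ ω, F (D ω) (Y ω) ∂P = ∫ d, ∫ x, F d x ∂(P.map Y) ∂(P.map D) := by
    rw [← integral_prod (fun p : S × ℝ => F p.1 p.2) hFint', ← hprod,
      integral_map hDYm.aemeasurable hF.aestronglyMeasurable]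
  rw [h1, ← integral_map hD.aemeasurable hGm.aestronglyMeasurable]
  refine integral_mono hFint'.integral_prod_left
    ((integrable_map_measure hGm.aestronglyMeasurable hD.aemeasurable).2 hG) fun d => ?_
  dsimp only
  rw [map_eq_of_isUniform hU, ← intervalIntegral.integral_of_le zero_le_one]
  exact hFG d

/-- Only the costs up to time `i` are assumed measurable, so that this also applies with the
σ-algebra of the natural filtration at time `i`. -/
theorem measurable_phaseAfter {X : ℕ → Ω → ℝ} (n : ℕ) {i : ℕ} (hX : ∀ j ≤ i, Measurable (X j)) :
    Measurable fun ω => phaseAfter n (fun j => X j ω) i := by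
  induction i with
  | zero => exact measurable_const
  | succ i ih =>
    exact (measurable_nextPhase n (i + 1)).comp
      ((ih fun j hj => hX j (by omega)).prodMk (hX (i + 1) le_rfl))

theorem indepFun_phaseAfter {P : Measure Ω} {X : ℕ → Ω → ℝ} (hX : ∀ i, Measurable (X i))
    (hindep : iIndepFun X P) (n i : ℕ) :
    IndepFun (fun ω => phaseAfter n (fun j => X j ω) i) (X (i + 1)) P := by
  have h := (hindep.indep_comap_natural_of_lt (fun j => (hX j).stronglyMeasurable)
    (Nat.lt_succ_self i)).symm
  refine indep_of_indep_of_le_left h ?_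
  refine Measurable.comap_le ?_
  refine @measurable_phaseAfter Ω (Filtration.natural X
    (fun j => (hX j).stronglyMeasurable) i) X n i fun j hj => ?_
  rw [measurable_iff_comap_le]
  exact le_iSup₂ (f := fun j (_ : j ≤ i) => MeasurableSpace.comap (X j) _) j hj

end ExpectedCost

/-! ### Summing the one-step inequalities -/

section ExpectedCost

variable {Ω : Type*} [MeasurableSpace Ω] {P : Measure Ω} {X : ℕ → Ω → ℝ}

theorem sum_Icc_one_eq_sum_range (n : ℕ) (f : ℕ → ℝ) :
    ∑ i ∈ Finset.Icc 1 n, f i = ∑ i ∈ Finset.range n, f (i + 1) := by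
  induction n with
  | zero => simp
  | succ n ih => rw [Finset.sum_Icc_succ_top (by omega), ih, Finset.sum_range_succ]

theorem ae_planCost_algorithm_eq (hX : ∀ i, Measurable (X i))
    (hU : ∀ i, pdf.IsUniform (X i) (Set.Icc (0 : ℝ) 1) P volume) (n : ℕ) :
    (fun ω => planCost n (algorithm (3 / 4) n fun i => X i ω) fun i => X i ω) =ᵐ[P]
      fun ω => ∑ i ∈ Finset.range n,
        (duration (phaseAfter n (fun j => X j ω) i) (X (i + 1) ω) : ℝ) * X (i + 1) ω := by
  filter_upwards [ae_all_iff.2 fun i => ae_mem_Ioc_of_isUniform (hX i) (hU i)] with ω hω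
  rw [planCost, sum_Icc_one_eq_sum_range]
  exact Finset.sum_congr rfl fun i hi => by
    rw [algorithm_eq_duration (fun j _ => hω j) (Finset.mem_range.1 hi)]

theorem ae_planCost_truncatedAlgorithm_eq (hX : ∀ i, Measurable (X i))
    (hU : ∀ i, pdf.IsUniform (X i) (Set.Icc (0 : ℝ) 1) P volume) (n : ℕ) :
    (fun ω => planCost n (truncatedAlgorithm (3 / 4) n fun i => X i ω) fun i => X i ω) =ᵐ[P]
      fun ω => ∑ i ∈ Finset.range n, ((min (duration (phaseAfter n (fun j => X j ω) i)
        (X (i + 1) ω)) (n + 1 - (i + 1)) : ℕ) : ℝ) * X (i + 1) ω := by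
  filter_upwards [ae_all_iff.2 fun i => ae_mem_Ioc_of_isUniform (hX i) (hU i)] with ω hω
  rw [planCost, sum_Icc_one_eq_sum_range]
  exact Finset.sum_congr rfl fun i hi => by
    rw [truncatedAlgorithm, algorithm_eq_duration (fun j _ => hω j) (Finset.mem_range.1 hi)]

theorem measurable_duration_phaseAfter (hX : ∀ i, Measurable (X i)) (n i : ℕ) :
    Measurable fun ω => duration (phaseAfter n (fun j => X j ω) i) (X (i + 1) ω) :=
  measurable_duration.comp ((measurable_phaseAfter n fun j _ => hX j).prodMk (hX (i + 1)))

variable [IsProbabilityMeasure P]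

theorem integrable_comp_duration_mul (hX : ∀ i, Measurable (X i))
    (hU : ∀ i, pdf.IsUniform (X i) (Set.Icc (0 : ℝ) 1) P volume) (n i : ℕ) {f : ℕ → ℕ}
    (hf : ∀ m, f m ≤ m) :
    Integrable (fun ω => (f (duration (phaseAfter n (fun j => X j ω) i) (X (i + 1) ω)) : ℝ) *
      X (i + 1) ω) P := by
  refine integrable_of_ae_le (((Measurable.of_discrete (f := fun m : ℕ => (f m : ℝ))).comp
    (measurable_duration_phaseAfter hX n i)).mul (hX (i + 1))).aestronglyMeasurable 3 ?_
  filter_upwards [ae_mem_Ioc_of_isUniform (hX (i + 1)) (hU (i + 1))] with ω hω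
  refine ⟨mul_nonneg (Nat.cast_nonneg _) hω.1.le, le_trans ?_
    (duration_mul_mem (phaseAfter n (fun j => X j ω) i) hω.1).2⟩
  exact mul_le_mul_of_nonneg_right (by exact_mod_cast hf _) hω.1.le

theorem integrable_duration_mul (hX : ∀ i, Measurable (X i))
    (hU : ∀ i, pdf.IsUniform (X i) (Set.Icc (0 : ℝ) 1) P volume) (n i : ℕ) :
    Integrable (fun ω => (duration (phaseAfter n (fun j => X j ω) i) (X (i + 1) ω) : ℝ) *
      X (i + 1) ω) P :=
  integrable_comp_duration_mul hX hU n i (f := id) fun _ => le_rfl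

theorem integrable_planCost_algorithm (hX : ∀ i, Measurable (X i))
    (hU : ∀ i, pdf.IsUniform (X i) (Set.Icc (0 : ℝ) 1) P volume) (n : ℕ) :
    Integrable (fun ω => planCost n (algorithm (3 / 4) n fun i => X i ω) fun i => X i ω) P := by
  rw [integrable_congr (ae_planCost_algorithm_eq hX hU n)]
  exact integrable_finsetSum _ fun i _ =>
    integrable_duration_mul hX hU n i

theorem integrable_planCost_truncatedAlgorithm (hX : ∀ i, Measurable (X i))
    (hU : ∀ i, pdf.IsUniform (X i) (Set.Icc (0 : ℝ) 1) P volume) (n : ℕ) :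
    Integrable
      (fun ω => planCost n (truncatedAlgorithm (3 / 4) n fun i => X i ω) fun i => X i ω) P := by
  rw [integrable_congr (ae_planCost_truncatedAlgorithm_eq hX hU n)]
  exact integrable_finsetSum _ fun i _ =>
    integrable_comp_duration_mul hX hU n i (f := fun m => min m (n + 1 - (i + 1)))
      fun _ => min_le_left _ _

theorem integrable_costBound_self (hX : ∀ i, Measurable (X i)) (K n i : ℕ) :
    Integrable (fun ω => costBound K K (phaseAfter n (fun j => X j ω) i)) P :=
  integrable_of_ae_le ((Measurable.of_discrete (f := costBound K K)).comp
    (measurable_phaseAfter n fun j _ => hX j)).aestronglyMeasurable _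
    (Filter.Eventually.of_forall fun _ => costBound_self_mem K _)

theorem integral_step_le (hX : ∀ i, Measurable (X i)) (hindep : iIndepFun X P)
    (hU : ∀ i, pdf.IsUniform (X i) (Set.Icc (0 : ℝ) 1) P volume) {K L n i : ℕ}
    (hL : n < i + 1 + contractLength L)
    (hint : Integrable (fun ω => costBound K L (phaseAfter n (fun j => X j ω) i)) P) :
    ∫ ω, (duration (phaseAfter n (fun j => X j ω) i) (X (i + 1) ω) : ℝ) * X (i + 1) ω ∂P +
        ∫ ω, costBound K K (phaseAfter n (fun j => X j ω) (i + 1)) ∂P ≤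
      ∫ ω, costBound K L (phaseAfter n (fun j => X j ω) i) ∂P := by
  rw [← integral_add (integrable_duration_mul hX hU n i)
    (integrable_costBound_self hX K n (i + 1))]
  exact (integral_le_of_indepFun (measurable_phaseAfter n fun j _ => hX j) (hX (i + 1))
    (hU (i + 1)) (indepFun_phaseAfter hX hindep n i) (measurable_stepCost K n (i + 1))
    (fun d x h0 _ => stepCost_mem K n (i + 1) d h0) hint Measurable.of_discrete
    (integral_stepCost_le K hL)).2

/-- The one-step inequalities telescope and the potential left at the end is non-negative. `L`
serves the first step only: there finality of its level needs `n ≤ contractLength L`, whereas from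
the second step on `n ≤ contractLength K + 1` suffices for `K`. -/
theorem integral_planCost_algorithm_le (hX : ∀ i, Measurable (X i)) (hindep : iIndepFun X P)
    (hU : ∀ i, pdf.IsUniform (X i) (Set.Icc (0 : ℝ) 1) P volume) {K L n : ℕ} (hn : 1 ≤ n)
    (hK : n ≤ contractLength K + 1) (hL : n ≤ contractLength L) :
    ∫ ω, planCost n (algorithm (3 / 4) n fun i => X i ω) (fun i => X i ω) ∂P ≤
      9 / 4 * totalHires K L := by
  have key : ∀ m, 1 ≤ m → ∑ i ∈ Finset.range m,
      ∫ ω, (duration (phaseAfter n (fun j => X j ω) i) (X (i + 1) ω) : ℝ) * X (i + 1) ω ∂P +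
        ∫ ω, costBound K K (phaseAfter n (fun j => X j ω) m) ∂P ≤ 9 / 4 * totalHires K L := by
    intro m hm
    induction m, hm using Nat.le_induction with
    | base =>
      have h := integral_step_le hX hindep hU (K := K) (L := L) (n := n) (i := 0) (by omega)
        (integrable_const (costBound K L (some (0, 0))))
      simp only [phaseAfter.eq_1, costBound_init, integral_const, probReal_univ, one_smul] at h
      simpa [phaseAfter.eq_1] using h
    | succ m hm ih =>
      have h := integral_step_le hX hindep hU (K := K) (L := K) (n := n) (i := m) (by omega)
        (integrable_costBound_self hX K n m)
      rw [Finset.sum_range_succ]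
      linarith
  have h0 : 0 ≤ ∫ ω, costBound K K (phaseAfter n (fun j => X j ω) n) ∂P :=
    integral_nonneg fun _ => (costBound_self_mem K _).1
  rw [integral_congr_ae (ae_planCost_algorithm_eq hX hU n), integral_finsetSum _ fun i _ =>
    integrable_duration_mul hX hU n i]
  linarith [key n hn]

end ExpectedCost

end HiringOverTime

theorem mainTheorem1 {Ω : Type*} [MeasurableSpace Ω] (P : Measure Ω) [IsProbabilityMeasure P]
    (X : ℕ → Ω → ℝ) (hmeas : ∀ i, Measurable (X i)) (hindep : iIndepFun X P)
    (hunif : ∀ i, pdf.IsUniform (X i) (Set.Icc (0 : ℝ) 1) P volume) (n : ℕ) (hn : 1 ≤ n) :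
    HiringOverTime.IsOnline (HiringOverTime.algorithm (3 / 4) n) ∧
    HiringOverTime.IsOnline (HiringOverTime.truncatedAlgorithm (3 / 4) n) ∧
    (∀ x : ℕ → ℝ, (∀ i ∈ Finset.Icc 1 n, 0 < x i ∧ x i ≤ 1) →
      HiringOverTime.Covers n (HiringOverTime.algorithm (3 / 4) n x) ∧
      HiringOverTime.Covers n (HiringOverTime.truncatedAlgorithm (3 / 4) n x)) ∧
    Integrable (fun ω => HiringOverTime.offlineOpt n (fun i => X i ω)) P ∧
    ∫ ω, HiringOverTime.offlineOpt n (fun i => X i ω) ∂P = ((harmonic (n + 1) : ℚ) : ℝ) - 1 ∧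
    Integrable (fun ω => HiringOverTime.planCost n
      (HiringOverTime.truncatedAlgorithm (3 / 4) n (fun i => X i ω)) (fun i => X i ω)) P ∧
    ∫ ω, HiringOverTime.planCost n
        (HiringOverTime.truncatedAlgorithm (3 / 4) n (fun i => X i ω)) (fun i => X i ω) ∂P
      ≤ 2.965 * ∫ ω, HiringOverTime.offlineOpt n (fun i => X i ω) ∂P ∧
    Integrable (fun ω => HiringOverTime.planCost n
      (HiringOverTime.algorithm (3 / 4) n (fun i => X i ω)) (fun i => X i ω)) P ∧
    (2 ≤ n →
      ∫ ω, HiringOverTime.planCost n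
          (HiringOverTime.algorithm (3 / 4) n (fun i => X i ω)) (fun i => X i ω) ∂P
        ≤ 2.965 * ∫ ω, HiringOverTime.offlineOpt n (fun i => X i ω) ∂P) := by
  have hae := ae_all_iff.2 fun i => HiringOverTime.ae_mem_Ioc_of_isUniform (hmeas i) (hunif i)
  have hopt := HiringOverTime.integral_offlineOpt hmeas hindep hunif n
  have halg := HiringOverTime.integrable_planCost_algorithm hmeas hunif n
  have htrunc := HiringOverTime.integrable_planCost_truncatedAlgorithm hmeas hunif n
  have hfull : 2 ≤ n → ∫ ω, HiringOverTime.planCost n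
      (HiringOverTime.algorithm (3 / 4) n (fun i => X i ω)) (fun i => X i ω) ∂P
        ≤ 2.965 * ∫ ω, HiringOverTime.offlineOpt n (fun i => X i ω) ∂P := by
    intro h2
    obtain ⟨K, L, hK, hL, hle⟩ := HiringOverTime.exists_totalHires_le h2
    rw [hopt]
    exact (HiringOverTime.integral_planCost_algorithm_le hmeas hindep hunif hn hK hL).trans hle
  refine ⟨HiringOverTime.isOnline_algorithm _ n, HiringOverTime.isOnline_truncatedAlgorithm _ n,
    fun x hx => ⟨HiringOverTime.covers_algorithm hx,
      (HiringOverTime.covers_algorithm hx).min_remaining⟩,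
    HiringOverTime.integrable_offlineOpt hmeas hunif n, hopt, htrunc, ?_, halg, hfull⟩
  -- For n = 1 the full contract has mean cost 9/4 > 2.965/2, but the truncated one pays at most the
  -- single cost, which is the optimum. For n ≥ 2 truncation only lowers the full cost.
  rcases Nat.lt_or_ge n 2 with h | h
  · obtain rfl : n = 1 := by omega
    have hle : ∀ᵐ ω ∂P, HiringOverTime.planCost 1 (HiringOverTime.truncatedAlgorithm (3 / 4) 1
        (fun i => X i ω)) (fun i => X i ω) ≤ HiringOverTime.offlineOpt 1 (fun i => X i ω) := by
      filter_upwards [hae] with ω hω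
      rw [HiringOverTime.offlineOpt_eq fun i _ => (hω i).1.le]
      simp only [HiringOverTime.planCost, Finset.Icc_self, Finset.sum_singleton]
      have h1 : HiringOverTime.truncatedAlgorithm (3 / 4) 1 (fun i => X i ω) 1 ≤ 1 :=
        min_le_right _ _
      have h1' : (HiringOverTime.truncatedAlgorithm (3 / 4) 1 (fun i => X i ω) 1 : ℝ) ≤ 1 := by
        exact_mod_cast h1
      have hself : HiringOverTime.argminUpTo (fun i => X i ω) 1 = 1 := by
        simp [HiringOverTime.argminUpTo]
      rw [hself]
      exact mul_le_of_le_one_left (hω 1).1.le h1'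
    have := integral_mono_ae htrunc (HiringOverTime.integrable_offlineOpt hmeas hunif 1) hle
    have h0 : 0 ≤ ∫ ω, HiringOverTime.offlineOpt 1 (fun i => X i ω) ∂P := by
      rw [hopt]
      norm_num [harmonic, Finset.sum_range_succ]
    linarith
  · refine le_trans (integral_mono_ae htrunc halg ?_) (hfull h)
    filter_upwards [hae] with ω hω
    refine Finset.sum_le_sum fun i _ => mul_le_mul_of_nonneg_right ?_ (hω i).1.le
    exact_mod_cast min_le_left _ _
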